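/- **Model.** A network is a connected $n$-node graph $G$ whose nodes have the identifiers $0,\dots,n-1$; the input of a node consists of its identifier, the identifier of its parent in a spanning tree of $G$ rooted at node $0$, and a label. An $(r,\ell)$ distributed interactive proof has $r=r(n)$ alternating rounds, the last one the prover's: in a prover round an unbounded, randomized prover, who knows the network and all earlier messages of the nodes, sends $\ell(n)$ bits to each node; in a verifier round each node sends the prover $\ell(n)$ bits computed from its input, its private coins and the prover messages that it received before. Afterwards the nodes run a verification algorithm, without the prover, and each of them accepts or rejects. $\mathcal C[c,b]$ denotes the distributed algorithms with $c$ synchronous rounds in which neighbours exchange at most $b(n)$ bits per edge direction and round. The view of a node consists of its coins and of all messages that it receives from the prover and from its neighbours. A set $\mathcal L$ of networks is in $\mathrm{dStatZK}[r,\ell,\mathcal C[c,b]]$ if there are such a proof with verification algorithm in $\mathcal C[c,b]$, an honest prover, and a randomized simulator in $\mathcal C[c,b]$ (which has no prover and starts from the inputs of the nodes only) such that * for every network in $\mathcal L$, the honest prover makes all nodes accept with probability at least $2/3$; * for every network not in $\mathcal L$ and every prover, all nodes accept with probability at most $1/3$; * for every polynomial $p$ and all sufficiently large $n$, for every $n$-node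 network in $\mathcal L$ and every node $v$, the total variation distance between the output of the simulator at $v$ and the view of $v$ in the interaction with the honest prover is at most $1/p(n)$. **Theorem.** Let $k=k(n)$, let $H=H_n$ be a graph on $k$ nodes (known to all nodes), and let $q=q(n)$ be a prime such that either $k\in\mathcal O(1)$ and $q\in n^{\omega(1)}$, or $k\in\omega(1)$ and $q>n^k$ for all large $n$. Let $\textsc{subgraph-counting}(H)$ be the set of networks in which the label of every node is one and the same number $\Delta$ and the number of copies of $H$ in $G$ is exactly $\Delta$. Here the copies are either all subgraphs of $G$ isomorphic to $H$, or only the induced ones, and the theorem holds for both versions. Then $$\textsc{subgraph-counting}(H)\in \mathrm{dStatZK}\bigl[\mathcal O(k\log n),\ \mathcal O(\log q),\ \mathcal C[\mathcal O(1),\mathcal O(\log q)]\bigr],$$ where the constants in the $\mathcal O$'s are absolute (and the bounds that depend on $n$ hold for all sufficiently large $n$). -/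

import Mathlib

noncomputable section

namespace DistZK

/-! ### Networks and distributed languages -/

/-- An `n`-node connected communication graph together with the input of every node. The node with
identifier `i ∈ {0, …, n-1}` is the vertex `i`. Besides its identifier, the input of a node contains
the identifier of its parent in some spanning tree of the graph rooted at node `0` (by convention
the root is its own parent) and a problem-specific label. -/
structure Network (n : ℕ) (Λ : Type) where
  graph : SimpleGraph (Fin n)
  connected : graph.Connected
  parent : Fin n → Fin n
  parent_root : ∀ v, v.val = 0 → parent v = v
  adj_parent : ∀ v, v.val ≠ 0 → graph.Adj v (parent v)
  reaches_root : ∀ v, ∃ m : ℕ, (parent^[m] v).val = 0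
  label : Fin n → Λ

/-- What a node knows before any communication takes place. -/
structure LocalInput (n : ℕ) (Λ : Type) where
  id : Fin n
  parent : Fin n
  label : Λ

/-- The input of node `v`. -/
def Network.input {n : ℕ} {Λ : Type} (N : Network n Λ) (v : Fin n) : LocalInput n Λ :=
  ⟨v, N.parent v, N.label v⟩

/-- A distributed language: a set of networks with inputs (of every size `n`). -/
def DistLanguage (Λ : Type) : Type := (n : ℕ) → Set (Network n Λ)

/-! ### Distributed algorithms -/

/-- Messages of `b` bits. -/
abbrev Msg (b : ℕ) : Type := Fin b → Bool

/-- What a node receives in one communication round: one message from every neighbour (indexed by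
the identifier of the sender), and nothing from the other nodes. -/
abbrev Inbox (n b : ℕ) : Type := Fin n → Option (Msg b)

/-- A synchronous distributed algorithm on `n`-node networks with `b`-bit messages. In each round
every node computes, from its local data and the list of its previous inboxes, one message for each
of its neighbours; when the communication is over it computes its output. -/
structure LocalAlg (n b : ℕ) (In Out : Type) where
  send : In → List (Inbox n b) → Fin n → Msg b
  out : In → List (Inbox n b) → Out

open Classical in
/-- The list of inboxes of node `v` after `t` communication rounds on the graph `G`. -/
def LocalAlg.received {n b : ℕ} {In Out : Type} (A : LocalAlg n b In Out)
    (G : SimpleGraph (Fin n)) (inp : Fin n → In) : ℕ → Fin n → List (Inbox n b)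
  | 0, _ => []
  | t + 1, v => A.received G inp t v ++
      [fun u => if G.Adj u v then some (A.send (inp u) (A.received G inp t u) v) else none]

/-- The output of node `v` when the algorithm is run for `c` communication rounds. -/
def LocalAlg.run {n b : ℕ} {In Out : Type} (A : LocalAlg n b In Out) (c : ℕ)
    (G : SimpleGraph (Fin n)) (inp : Fin n → In) (v : Fin n) : Out :=
  A.out (inp v) (A.received G inp c v)

/-- The parameters of the class `C[c, b]` of distributed algorithms which run for `c` rounds and
send at most `b n` bits over every edge (in each direction) in each round on `n`-node networks. -/
structure AlgClass where
  rounds : ℕ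
  bits : ℕ → ℕ

/-! ### Distributed interactive proofs -/

/-- The verifier of a distributed interactive proof on `n`-node networks, with `ℓ`-bit messages
between nodes and prover and `b`-bit messages between neighbours in the verification phase. Every
node draws its private randomness independently and uniformly from the finite set `Coin`.
`respond` gives the next message of a node to the prover, from the messages that this node has
received so far from the prover; `verify` is the algorithm that is run after the interaction. -/
structure Verifier (n ℓ b : ℕ) (Λ : Type) where
  Coin : Type
  [fintypeCoin : Fintype Coin]
  [nonemptyCoin : Nonempty Coin]
  respond : LocalInput n Λ → Coin → List (Msg ℓ) → Msg ℓ
  verify : LocalAlg n b (LocalInput n Λ × Coin × List (Msg ℓ)) Bool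

attribute [instance] Verifier.fintypeCoin Verifier.nonemptyCoin

/-- A (randomized, computationally unbounded) prover, for a fixed network. The messages that it
sends in its next round depend on its private randomness, uniform on `Seed`, and on all the messages
that it has received from the nodes in the previous rounds. -/
structure Prover (n ℓ : ℕ) where
  Seed : Type
  [fintypeSeed : Fintype Seed]
  [nonemptySeed : Nonempty Seed]
  strategy : Seed → List (Fin n → Msg ℓ) → Fin n → Msg ℓ

attribute [instance] Prover.fintypeSeed Prover.nonemptySeed

/-- The messages exchanged so far: those received by each node from the prover, and those received
by the prover from the nodes. -/
structure Transcript (n ℓ : ℕ) where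
  toNode : Fin n → List (Msg ℓ)
  toProver : List (Fin n → Msg ℓ)

section Execution

variable {n ℓ b : ℕ} {Λ : Type} (V : Verifier n ℓ b Λ) (P : Prover n ℓ) (N : Network n Λ)

/-- The joint randomness of the prover and of all the nodes. -/
abbrev Randomness : Type := P.Seed × (Fin n → V.Coin)

open Classical in
/-- The transcript after the first `i` of `r` rounds of interaction. The rounds alternate between
the prover and the nodes, and the last one (round `r - 1`, counted from `0`) is the prover's. -/
def interact (r : ℕ) (ω : Randomness V P) : ℕ → Transcript n ℓ
  | 0 => ⟨fun _ => [], []⟩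
  | i + 1 =>
    let T := interact r ω i
    if Odd (r - i) then
      ⟨fun v => T.toNode v ++ [P.strategy ω.1 T.toProver v], T.toProver⟩
    else
      ⟨T.toNode, T.toProver ++ [fun v => V.respond (N.input v) (ω.2 v) (T.toNode v)]⟩

/-- The local data with which node `v` starts the verification phase. -/
def verifyInput (r : ℕ) (ω : Randomness V P) (v : Fin n) :
    LocalInput n Λ × V.Coin × List (Msg ℓ) :=
  (N.input v, ω.2 v, (interact V P N r ω r).toNode v)

/-- All nodes accept, after `r` rounds of interaction and `c` rounds of verification. -/
def AllAccept (r c : ℕ) (ω : Randomness V P) : Prop :=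
  ∀ v, V.verify.run c N.graph (verifyInput V P N r ω) v = true

/-- The probability that all nodes accept. -/
def acceptProb (r c : ℕ) : ENNReal :=
  (PMF.uniformOfFintype (Randomness V P)).toOuterMeasure {ω | AllAccept V P N r c ω}

end Execution

/-! ### Zero knowledge -/

/-- The possible views of one node: its private randomness, all the messages it receives from the
prover and all the messages it receives from its neighbours. -/
structure View (n ℓ b : ℕ) (Coin : Type) where
  coin : Coin
  fromProver : List (Msg ℓ)
  fromNeighbors : List (Inbox n b)

/-- The distribution of the view of node `v` in the interactive proof. -/
def viewDist {n ℓ b : ℕ} {Λ : Type} (V : Verifier n ℓ b Λ) (P : Prover n ℓ) (N : Network n Λ)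
    (r c : ℕ) (v : Fin n) : PMF (View n ℓ b V.Coin) :=
  (PMF.uniformOfFintype (Randomness V P)).map fun ω =>
    ⟨ω.2 v, (interact V P N r ω r).toNode v,
      V.verify.received N.graph (verifyInput V P N r ω) c v⟩

/-- A simulator: a randomized distributed algorithm, without prover, in which every node starts
from its own input and private randomness, uniform on `Coin`, and outputs an element of `Out`. -/
structure Simulator (n b : ℕ) (Λ Out : Type) where
  Coin : Type
  [fintypeCoin : Fintype Coin]
  [nonemptyCoin : Nonempty Coin]
  alg : LocalAlg n b (LocalInput n Λ × Coin) Out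

attribute [instance] Simulator.fintypeCoin Simulator.nonemptyCoin

/-- The distribution of the output of the simulator at node `v`. -/
def simDist {n b : ℕ} {Λ Out : Type} (S : Simulator n b Λ Out) (N : Network n Λ) (c : ℕ)
    (v : Fin n) : PMF Out :=
  (PMF.uniformOfFintype (Fin n → S.Coin)).map fun κ =>
    S.alg.run c N.graph (fun u => (N.input u, κ u)) v

/-- Total variation distance of two discrete distributions. -/
def tvDist {α : Type} (μ ν : PMF α) : ℝ := (∑' x, |(μ x).toReal - (ν x).toReal|) / 2

/-- The class `dStatZK[r, ℓ, AV, AS]`. There are a verifier (for each network size `n`) with `r n`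
rounds of interaction, `ℓ n`-bit messages and verification algorithm in `AV`, an honest prover and a
simulator in `AS` such that: the honest prover makes all nodes accept a yes-instance with
probability at least `2/3`; no prover makes all nodes accept a no-instance with probability more
than `1/3`; and on yes-instances with the honest prover, the view of every single node is
statistically indistinguishable from the output of the simulator at this node, i.e. for every
polynomial `p` the distance is at most `1 / p n` for all large `n`. -/
def DStatZK {Λ : Type} (r ℓ : ℕ → ℕ) (AV AS : AlgClass) (L : DistLanguage Λ) : Prop :=
  ∃ (V : (n : ℕ) → Verifier n (ℓ n) (AV.bits n) Λ)
    (honest : (n : ℕ) → Network n Λ → Prover n (ℓ n))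
    (S : (n : ℕ) → Simulator n (AS.bits n) Λ (View n (ℓ n) (AV.bits n) (V n).Coin)),
    (∀ (n : ℕ) (N : Network n Λ), N ∈ L n →
      2 / 3 ≤ acceptProb (V n) (honest n N) N (r n) AV.rounds) ∧
    (∀ (n : ℕ) (N : Network n Λ), N ∉ L n → ∀ P : Prover n (ℓ n),
      acceptProb (V n) P N (r n) AV.rounds ≤ 1 / 3) ∧
    (∀ p : Polynomial ℕ, ∀ᶠ n : ℕ in Filter.atTop, ∀ N : Network n Λ, N ∈ L n → ∀ v : Fin n,
      ((p.eval n : ℕ) : ℝ) * tvDist (simDist (S n) N AS.rounds v)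
        (viewDist (V n) (honest n N) N (r n) AV.rounds v) ≤ 1)

/-! ### Subgraph counting -/

open Classical in
/-- The number of induced copies of `H` in `G`: the number of vertex sets on which `G` induces a
graph isomorphic to `H`. -/
def inducedCopyCount {n k : ℕ} (G : SimpleGraph (Fin n)) (H : SimpleGraph (Fin k)) : ℕ :=
  (Finset.univ.filter fun s : Finset (Fin n) =>
    Nonempty (H ≃g G.induce (s : Set (Fin n)))).card

/-- Non-induced subgraph counting. The pattern for `n`-node networks is `H n`, with `k n` nodes. The
label of each node is the claimed number `Δ` of copies, the same for all nodes. -/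
def subgraphCounting {k : ℕ → ℕ} (H : (n : ℕ) → SimpleGraph (Fin (k n))) : DistLanguage ℕ :=
  fun n => {N | ∃ Δ : ℕ, (∀ v, N.label v = Δ) ∧ N.graph.copyCount (H n) = Δ}

/-- Induced subgraph counting. -/
def inducedSubgraphCounting {k : ℕ → ℕ} (H : (n : ℕ) → SimpleGraph (Fin (k n))) :
    DistLanguage ℕ :=
  fun n => {N | ∃ Δ : ℕ, (∀ v, N.label v = Δ) ∧ inducedCopyCount N.graph (H n) = Δ}

end DistZK

end

noncomputable section

namespace DistZK

/-! ### Labelled and unlabelled copies -/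

section Copies

variable {n k : ℕ}

/-! The number of copies of `H` times `|Aut H|` is the number of `k`-tuples of distinct vertices
satisfying pairwise adjacency constraints (`copyCount_mul_card_iso`,
`inducedCopyCount_mul_card_iso`). Writing each entry with `m = ⌈log₂ n⌉` bits turns this number into
a sum over the Boolean cube in `T = k m` variables of a polynomial over a prime field
(`cubeSum_prodPoly`). The polynomial is a product of `k - 1` factors, one for each entry after the
first. Each factor is a sum over the nodes of terms that a node computes from its own adjacency row,
and has degree at most one in every variable. Hence the sumcheck protocol applies, with round
polynomials of degree less than `n`: one coefficient per node.

The product of the factors is not a sum of local terms, and its factors must stay hidden. So the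
last polynomial is `z ↦ ∏ (factor_i + z μ_i)`, with masks `μ_i` fixed earlier and shared additively
by the nodes. At `z = 0` it is the required value; at a random nonzero `z` the prover may reveal the
masked factors, which are uniform. All checks are then sums over the nodes. They are batched with
powers of the last coin and added up along the spanning tree. The coins are those of the root,
returned by the prover to everybody; neighbours compare only the last coin and a fingerprint of the
others, so that messages stay short.

Soundness: a wrong claim makes every round polynomial wrong (`claim_eq_of_eqns`), so acceptance
needs a coincidence at a coin drawn after the relevant messages: in a round, in a fingerprint or in
the batching. A root count and a union bound make this rare (`acceptProb_le`).

Zero knowledge is perfect. Every coefficient is split between two different nodes, the factors are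
masked by the `μ_i`, and the subtree sums by further masks. For each node a bijection of the
randomness turns its view into what the simulator writes down from uniform values
(`reveal_injective`, `simView_reveal`, `simDist_eq_viewDist`). -/

instance finite_iso {V W : Type*} [Finite V] [Finite W] (G : SimpleGraph V) (H : SimpleGraph W) :
    Finite (G ≃g H) :=
  DFunLike.finite _

lemma card_iso_eq {U V : Type*} {G : SimpleGraph U} {H : SimpleGraph V}
    (h : Nonempty (H ≃g G)) : Nat.card (H ≃g G) = Nat.card (H ≃g H) := by
  obtain ⟨e⟩ := h
  exact Nat.card_congr
    { toFun := fun f => f.trans e.symm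
      invFun := fun f => f.trans e
      left_inv := fun f => by ext; simp
      right_inv := fun f => by ext; simp }

open Classical in
lemma card_sigma_iso {ι W : Type*} [Fintype ι] [Finite W] {U : ι → Type*} [∀ i, Finite (U i)]
    (G : ∀ i, SimpleGraph (U i)) (H : SimpleGraph W) :
    Nat.card (Σ i, H ≃g G i) =
      (Finset.univ.filter fun i => Nonempty (H ≃g G i)).card * Nat.card (H ≃g H) := by
  rw [Nat.card_sigma, Finset.card_filter, Finset.sum_mul]
  refine Finset.sum_congr rfl fun i _ => ?_
  split_ifs with h
  · rw [card_iso_eq h, one_mul]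
  · rw [zero_mul, Nat.card_eq_zero]
    exact .inl (not_nonempty_iff.1 h)

/-- A labelled copy factors uniquely as an isomorphism onto its image subgraph followed by the
inclusion, and the isomorphisms onto a fixed image form a torsor under `Aut H`. -/
lemma card_copy (G : SimpleGraph (Fin n)) (H : SimpleGraph (Fin k)) :
    Nat.card (H.Copy G) = G.copyCount H * Nat.card (H ≃g H) := by
  classical
  have key := card_sigma_iso (fun G' : G.Subgraph => G'.coe) H
  have hc : G.copyCount H =
      (Finset.univ.filter fun G' : G.Subgraph => Nonempty (H ≃g G'.coe)).card := by
    rw [SimpleGraph.copyCount]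
    congr!
  rw [hc, ← key]
  refine (Nat.card_congr (Equiv.ofBijective
    (fun p : Σ G' : G.Subgraph, H ≃g G'.coe => p.1.coeCopy.comp p.2.toCopy) ⟨?_, ?_⟩)).symm
  · rintro ⟨G₁, e₁⟩ ⟨G₂, e₂⟩ h
    have hf : ∀ w, ((e₁ w : G₁.verts) : Fin n) = ((e₂ w : G₂.verts) : Fin n) := fun w =>
      DFunLike.congr_fun h w
    have hsub : ∀ (G₁ G₂ : G.Subgraph) (e₁ : H ≃g G₁.coe) (e₂ : H ≃g G₂.coe),
        (∀ w, ((e₁ w : G₁.verts) : Fin n) = ((e₂ w : G₂.verts) : Fin n)) → G₁ ≤ G₂ := by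
      intro G₁ G₂ e₁ e₂ hf
      constructor
      · intro v hv
        obtain ⟨w, hw⟩ := e₁.surjective ⟨v, hv⟩
        have := hf w
        rw [hw] at this
        rw [show v = _ from this]
        exact (e₂ w).2
      · intro a b hab
        obtain ⟨x, hx⟩ := e₁.surjective ⟨a, G₁.edge_vert hab⟩
        obtain ⟨y, hy⟩ := e₁.surjective ⟨b, G₁.edge_vert hab.symm⟩
        have h1 := hf x
        have h2 := hf y
        have hadj : H.Adj x y := by
          rw [← e₁.map_adj_iff, hx, hy]
          exact hab
        rw [hx] at h1
        rw [hy] at h2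
        have h3 : G₂.coe.Adj (e₂ x) (e₂ y) := e₂.map_adj_iff.2 hadj
        rw [SimpleGraph.Subgraph.coe_adj] at h3
        rw [show a = _ from h1, show b = _ from h2]
        exact h3
    obtain rfl : G₁ = G₂ :=
      le_antisymm (hsub _ _ e₁ e₂ hf) (hsub _ _ e₂ e₁ fun w => (hf w).symm)
    congr 1
    ext w
    exact congrArg Fin.val (hf w)
  · intro f
    refine ⟨⟨f.toSubgraph, f.isoToSubgraph⟩, ?_⟩
    ext w
    rfl

/-- As for `card_copy`, but the image of an induced copy is determined by its vertex set. -/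
lemma card_embedding (G : SimpleGraph (Fin n)) (H : SimpleGraph (Fin k)) :
    Nat.card (H ↪g G) = inducedCopyCount G H * Nat.card (H ≃g H) := by
  classical
  have key := card_sigma_iso (fun s : Finset (Fin n) => G.induce (s : Set (Fin n))) H
  have hc : inducedCopyCount G H = (Finset.univ.filter fun s : Finset (Fin n) =>
      Nonempty (H ≃g G.induce (s : Set (Fin n)))).card := by
    rw [inducedCopyCount]
  rw [hc, ← key]
  refine (Nat.card_congr (Equiv.ofBijective
    (fun p : Σ s : Finset (Fin n), H ≃g G.induce (s : Set (Fin n)) =>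
      (SimpleGraph.Embedding.induce (p.1 : Set (Fin n))).comp p.2.toEmbedding) ⟨?_, ?_⟩)).symm
  · rintro ⟨s₁, e₁⟩ ⟨s₂, e₂⟩ h
    have hf : ∀ w, (e₁ w : Fin n) = (e₂ w : Fin n) := fun w => DFunLike.congr_fun h w
    obtain rfl : s₁ = s₂ := by
      ext v
      constructor
      · intro hv
        obtain ⟨w, hw⟩ := e₁.surjective ⟨v, hv⟩
        have := hf w
        rw [hw] at this
        rw [show v = _ from this]
        exact (e₂ w).2
      · intro hv
        obtain ⟨w, hw⟩ := e₂.surjective ⟨v, hv⟩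
        have := hf w
        rw [hw] at this
        rw [show v = _ from this.symm]
        exact (e₁ w).2
    congr 1
    ext w
    exact congrArg Fin.val (hf w)
  · intro f
    refine ⟨⟨Finset.univ.image f, f.isoInduceRange.trans ?_⟩, ?_⟩
    · exact
        { toEquiv := Equiv.setCongr (by simp)
          map_rel_iff' := Iff.rfl }
    · ext w
      rfl

end Copies

/-! ### Valid tuples -/

open Classical in
/-- The number of `k`-tuples of vertices such that the entries are distinct and the adjacency of the
entries with indices `j < i` satisfies the constraint `pat i j`. -/
def tupleCount {n : ℕ} (pat : ℕ → ℕ → Bool → Bool) (k : ℕ) (G : SimpleGraph (Fin n)) : ℕ :=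
  (Finset.univ.filter fun φ : Fin k → Fin n => ∀ i j : Fin k, j < i →
    φ i ≠ φ j ∧ pat i j (decide (G.Adj (φ i) (φ j))) = true).card

lemma tupleCount_le {n : ℕ} (pat : ℕ → ℕ → Bool → Bool) (k : ℕ) (G : SimpleGraph (Fin n)) :
    tupleCount pat k G ≤ n ^ k := by
  classical
  refine (Finset.card_filter_le _ _).trans ?_
  simp

open Classical in
/-- The constraints on tuples which are copies of `H`. -/
def copyPat {k : ℕ} (H : SimpleGraph (Fin k)) (i j : ℕ) (g : Bool) : Bool :=
  if h : i < k ∧ j < k then decide (H.Adj ⟨i, h.1⟩ ⟨j, h.2⟩ → g = true) else true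

open Classical in
/-- The constraints on tuples which are induced copies of `H`. -/
def inducedPat {k : ℕ} (H : SimpleGraph (Fin k)) (i j : ℕ) (g : Bool) : Bool :=
  if h : i < k ∧ j < k then decide (H.Adj ⟨i, h.1⟩ ⟨j, h.2⟩ ↔ g = true) else true

lemma copyCount_mul_card_iso {n k : ℕ} (G : SimpleGraph (Fin n)) (H : SimpleGraph (Fin k)) :
    G.copyCount H * Nat.card (H ≃g H) = tupleCount (copyPat H) k G := by
  classical
  rw [← card_copy, tupleCount, ← Fintype.card_subtype, ← Nat.card_eq_fintype_card]
  refine Nat.card_congr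
    { toFun := fun f => ⟨f, fun i j hij => ⟨fun h => hij.ne' (f.injective h), ?_⟩⟩
      invFun := fun φ => ⟨⟨φ.1, ?_⟩, ?_⟩
      left_inv := fun f => by ext; rfl
      right_inv := fun φ => rfl }
  · simp only [copyPat, Fin.is_lt, and_self, dite_true, decide_eq_true_eq]
    exact fun h => f.toHom.map_adj h
  · intro a b hab
    rcases lt_or_gt_of_ne hab.ne with h | h
    · have := (φ.2 b a h).2
      simp only [copyPat, Fin.is_lt, and_self, dite_true, decide_eq_true_eq] at this
      exact (this hab.symm).symm
    · have := (φ.2 a b h).2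
      simp only [copyPat, Fin.is_lt, and_self, dite_true, decide_eq_true_eq] at this
      exact this hab
  · intro a b hab
    by_contra hne
    rcases lt_or_gt_of_ne hne with h | h
    · exact (φ.2 b a h).1 hab.symm
    · exact (φ.2 a b h).1 hab

lemma inducedCopyCount_mul_card_iso {n k : ℕ} (G : SimpleGraph (Fin n))
    (H : SimpleGraph (Fin k)) :
    inducedCopyCount G H * Nat.card (H ≃g H) = tupleCount (inducedPat H) k G := by
  classical
  rw [← card_embedding, tupleCount, ← Fintype.card_subtype, ← Nat.card_eq_fintype_card]
  refine Nat.card_congr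
    { toFun := fun f => ⟨f, fun i j hij => ⟨fun h => hij.ne' (f.injective h), ?_⟩⟩
      invFun := fun φ => ⟨⟨φ.1, ?_⟩, ?_⟩
      left_inv := fun f => by ext; rfl
      right_inv := fun φ => rfl }
  · simp only [inducedPat, Fin.is_lt, and_self, dite_true, decide_eq_true_eq]
    exact f.map_adj_iff.symm
  · intro a b hab
    by_contra hne
    rcases lt_or_gt_of_ne hne with h | h
    · exact (φ.2 b a h).1 hab.symm
    · exact (φ.2 a b h).1 hab
  · intro a b
    rcases lt_trichotomy a b with h | rfl | h
    · have := (φ.2 b a h).2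
      simp only [inducedPat, Fin.is_lt, and_self, dite_true, decide_eq_true_eq] at this
      rw [SimpleGraph.adj_comm, SimpleGraph.adj_comm H]
      exact this.symm
    · simp
    · have := (φ.2 a b h).2
      simp only [inducedPat, Fin.is_lt, and_self, dite_true, decide_eq_true_eq] at this
      exact this.symm

lemma card_iso_self_pos {k : ℕ} (H : SimpleGraph (Fin k)) : 0 < Nat.card (H ≃g H) :=
  Nat.card_pos_iff.2 ⟨⟨SimpleGraph.Iso.refl⟩, inferInstance⟩

/-- When the pattern has at most one vertex, or more vertices than the graph, the number of valid
tuples does not depend on the graph. -/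
lemma tupleCount_const {n k : ℕ} (h : k ≤ 1 ∨ n < k) (pat : ℕ → ℕ → Bool → Bool)
    (G G' : SimpleGraph (Fin n)) : tupleCount pat k G = tupleCount pat k G' := by
  classical
  unfold tupleCount
  congr 1
  refine Finset.filter_congr fun φ _ => ?_
  rcases h with h | h
  · have : ∀ i j : Fin k, ¬ j < i := fun i j hij => by have := i.2; omega
    simp [this]
  · have hφ : ¬ Function.Injective φ := fun hi => by
      have := Fintype.card_le_of_injective φ hi
      simp at this
      omega
    have : ∀ Q : Fin k → Fin k → Prop, ¬ ∀ i j : Fin k, j < i → φ i ≠ φ j ∧ Q i j := by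
      intro Q hQ
      refine hφ fun a b hab => ?_
      by_contra hne
      rcases lt_or_gt_of_ne hne with h | h
      · exact (hQ b a h).1 hab.symm
      · exact (hQ a b h).1 hab
    exact iff_of_false (this _) (this _)

open Finset Function

/-! ### Functions which are polynomial in one coordinate -/

section CoordDegree

variable {F : Type} [Field F]

/-- As a function of the coordinate `t`, `f` is given by a polynomial of degree at most `d`. -/
def DegLE (d t : ℕ) (f : (ℕ → F) → F) : Prop :=
  ∀ x, ∃ p : Polynomial F, p.natDegree ≤ d ∧ ∀ z, p.eval z = f (update x t z)

lemma DegLE.mono {d e t : ℕ} {f : (ℕ → F) → F} (h : DegLE d t f) (hde : d ≤ e) : DegLE e t f :=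
  fun x => let ⟨p, hp, he⟩ := h x; ⟨p, hp.trans hde, he⟩

lemma degLE_const (d t : ℕ) (c : F) : DegLE d t fun _ => c :=
  fun _ => ⟨Polynomial.C c, by simp, by simp⟩

lemma degLE_coord (t s : ℕ) : DegLE (if s = t then 1 else 0) t fun x : ℕ → F => x s := by
  intro x
  split_ifs with h
  · exact ⟨Polynomial.X, by simp, by simp [h]⟩
  · exact ⟨Polynomial.C (x s), by simp, by simp [h]⟩

lemma DegLE.add {d t : ℕ} {f g : (ℕ → F) → F} (hf : DegLE d t f) (hg : DegLE d t g) :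
    DegLE d t fun x => f x + g x := by
  intro x
  obtain ⟨p, hp, hpe⟩ := hf x
  obtain ⟨r, hr, hre⟩ := hg x
  exact ⟨p + r, (Polynomial.natDegree_add_le _ _).trans (max_le hp hr), by simp [hpe, hre]⟩

lemma DegLE.mul {d e t : ℕ} {f g : (ℕ → F) → F} (hf : DegLE d t f) (hg : DegLE e t g) :
    DegLE (d + e) t fun x => f x * g x := by
  intro x
  obtain ⟨p, hp, hpe⟩ := hf x
  obtain ⟨r, hr, hre⟩ := hg x
  exact ⟨p * r, Polynomial.natDegree_mul_le.trans (add_le_add hp hr), by simp [hpe, hre]⟩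

lemma DegLE.sub {d t : ℕ} {f g : (ℕ → F) → F} (hf : DegLE d t f) (hg : DegLE d t g) :
    DegLE d t fun x => f x - g x := by
  intro x
  obtain ⟨p, hp, hpe⟩ := hf x
  obtain ⟨r, hr, hre⟩ := hg x
  exact ⟨p - r, (Polynomial.natDegree_sub_le _ _).trans (max_le hp hr), by simp [hpe, hre]⟩

lemma degLE_sum {ι : Type*} {d t : ℕ} (s : Finset ι) {f : ι → (ℕ → F) → F}
    (h : ∀ i ∈ s, DegLE d t (f i)) : DegLE d t fun x => ∑ i ∈ s, f i x := by
  classical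
  induction s using Finset.induction_on with
  | empty => simpa using degLE_const d t 0
  | insert a s ha ih =>
    simp only [Finset.sum_insert ha]
    exact (h a (by simp)).add (ih fun i hi => h i (by simp [hi]))

lemma degLE_prod {ι : Type*} {t : ℕ} (s : Finset ι) {d : ι → ℕ} {f : ι → (ℕ → F) → F}
    (h : ∀ i ∈ s, DegLE (d i) t (f i)) : DegLE (∑ i ∈ s, d i) t fun x => ∏ i ∈ s, f i x := by
  classical
  induction s using Finset.induction_on with
  | empty => simpa using degLE_const 0 t 1
  | insert a s ha ih =>
    simp only [Finset.prod_insert ha, Finset.sum_insert ha]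
    exact (h a (by simp)).mul (ih fun i hi => h i (by simp [hi]))

lemma DegLE.update_other {d t s : ℕ} {f : (ℕ → F) → F} (hf : DegLE d t f) (hst : s ≠ t) (c : F) :
    DegLE d t fun x => f (update x s c) := by
  intro x
  obtain ⟨p, hp, hpe⟩ := hf (update x s c)
  exact ⟨p, hp, fun z => by rw [hpe, update_comm hst]⟩

/-- A function given by a polynomial of degree less than `n` is given by `n` coefficients. -/
lemma exists_coeffs {n d : ℕ} (hd : d < n) {g : F → F} (p : Polynomial F) (hp : p.natDegree ≤ d)
    (hg : ∀ z, p.eval z = g z) : ∃ c : Fin n → F, ∀ z, g z = ∑ j, c j * z ^ (j : ℕ) := by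
  refine ⟨fun j => p.coeff j, fun z => ?_⟩
  rw [← hg, Polynomial.eval_eq_sum_range' (lt_of_le_of_lt hp hd), ← Fin.sum_univ_eq_sum_range
    (fun j => p.coeff j * z ^ j) n]

/-- Polynomials with different vectors of `n` coefficients agree on fewer than `n` points. -/
lemma card_agree_lt {n : ℕ} [Fintype F] [DecidableEq F] {c c' : Fin n → F} (h : c ≠ c') :
    (univ.filter fun z : F => ∑ j, c j * z ^ (j : ℕ) = ∑ j, c' j * z ^ (j : ℕ)).card < n := by
  classical
  set p : Polynomial F := ∑ j : Fin n, Polynomial.monomial (j : ℕ) (c j - c' j) with hp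
  have he : ∀ z, p.eval z = ∑ j, c j * z ^ (j : ℕ) - ∑ j, c' j * z ^ (j : ℕ) := by
    intro z
    rw [hp, Polynomial.eval_finsetSum, ← Finset.sum_sub_distrib]
    simp
  obtain ⟨i, hi⟩ := Function.ne_iff.1 h
  have hp0 : p ≠ 0 := by
    intro h0
    have h1 : p.coeff i = c i - c' i := by
      simp [hp, Polynomial.finsetSum_coeff, Polynomial.coeff_monomial, Fin.val_inj]
    rw [h0, Polynomial.coeff_zero] at h1
    exact hi (sub_eq_zero.1 h1.symm)
  have hn : 0 < n := i.pos
  have hdeg : p.natDegree < n := by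
    refine lt_of_le_of_lt (Polynomial.natDegree_sum_le_of_forall_le (n := n - 1) _ _ ?_) (by omega)
    intro j _
    exact (Polynomial.natDegree_monomial_le _).trans (by have := j.2; omega)
  refine lt_of_le_of_lt ?_ hdeg
  refine (Finset.card_le_card ?_).trans (p.roots.toFinset_card_le.trans (Polynomial.card_roots' p))
  intro z hz
  simp only [mem_filter, mem_univ, true_and] at hz
  rw [Multiset.mem_toFinset, Polynomial.mem_roots hp0, Polynomial.IsRoot.def, he, hz, sub_self]

end CoordDegree

/-! ### Partial sums over the Boolean cube -/

section PartialSum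

variable {F : Type} [Field F]

/-- The sum of `f` over all Boolean values of the coordinates `t, …, t + d - 1`. -/
def cubeSum (f : (ℕ → F) → F) : ℕ → ℕ → (ℕ → F) → F
  | _, 0, x => f x
  | t, d + 1, x => cubeSum f (t + 1) d (update x t 0) + cubeSum f (t + 1) d (update x t 1)

lemma DegLE.cubeSum {e t : ℕ} {f : (ℕ → F) → F} (hf : DegLE e t f) :
    ∀ (d s : ℕ), t < s → DegLE e t (cubeSum f s d)
  | 0, _, _ => hf
  | d + 1, s, h =>
    ((DegLE.cubeSum hf d (s + 1) (by omega)).update_other (by omega) 0).add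
      ((DegLE.cubeSum hf d (s + 1) (by omega)).update_other (by omega) 1)

lemma cubeSum_congr {f : (ℕ → F) → F} {M : ℕ}
    (hf : ∀ x x' : ℕ → F, (∀ i < M, x i = x' i) → f x = f x') :
    ∀ (d t : ℕ), t + d = M → ∀ x x' : ℕ → F, (∀ i < t, x i = x' i) →
      cubeSum f t d x = cubeSum f t d x'
  | 0, t, h, x, x', hx => hf x x' (by rw [← h]; exact hx)
  | d + 1, t, h, x, x', hx => by
    have key : ∀ c, cubeSum f (t + 1) d (update x t c) = cubeSum f (t + 1) d (update x' t c) := by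
      intro c
      refine cubeSum_congr hf d (t + 1) (by omega) _ _ fun i hi => ?_
      rcases eq_or_ne i t with rfl | hit
      · simp
      · simp only [update_of_ne hit]
        exact hx i (by omega)
    simp only [cubeSum, key]

lemma cubeSum_eq_sum {f : (ℕ → F) → F} :
    ∀ (d t : ℕ) (x : ℕ → F), cubeSum f t d x = ∑ y : Fin d → Bool,
      f fun i => if h : t ≤ i ∧ i - t < d then (if y ⟨i - t, h.2⟩ then 1 else 0) else x i
  | 0, t, x => by simp [cubeSum]
  | d + 1, t, x => by
    rw [cubeSum, cubeSum_eq_sum d, cubeSum_eq_sum d, ← (Fin.consEquiv fun _ => Bool).sum_comp,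
      Fintype.sum_prod_type, Fintype.sum_bool, add_comm]
    have key : ∀ (b : Bool) (c : F) (y : Fin d → Bool), c = (if b then 1 else 0) →
        (fun i => if h : t + 1 ≤ i ∧ i - (t + 1) < d then
            (if y ⟨i - (t + 1), h.2⟩ then (1 : F) else 0) else update x t c i) =
          fun i => if h : t ≤ i ∧ i - t < d + 1 then
            (if (Fin.consEquiv fun _ => Bool) (b, y) ⟨i - t, h.2⟩ then 1 else 0) else x i := by
      intro b c y hc
      funext i
      rcases lt_trichotomy i t with h | rfl | h
      · rw [dif_neg (by omega), dif_neg (by omega), update_of_ne h.ne]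
      · rw [dif_neg (by omega), dif_pos ⟨le_rfl, by omega⟩, update_self, hc]
        have : (⟨i - i, by omega⟩ : Fin (d + 1)) = 0 := by ext; simp
        rw [this]
        simp [Fin.consEquiv]
      · by_cases hd : i - t < d + 1
        · rw [dif_pos ⟨by omega, by omega⟩, dif_pos ⟨by omega, hd⟩]
          have : (⟨i - t, hd⟩ : Fin (d + 1)) = Fin.succ ⟨i - (t + 1), by omega⟩ := by
            ext; simp; omega
          rw [this]
          simp only [Fin.consEquiv, Equiv.coe_fn_mk, Fin.cons_succ]
        · rw [dif_neg (by omega), dif_neg (by omega), update_of_ne h.ne']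
    congr 1
    · exact Finset.sum_congr rfl fun y _ => congrArg f (key true 1 y (by simp))
    · exact Finset.sum_congr rfl fun y _ => congrArg f (key false 0 y (by simp))

end PartialSum

/-! ### Arithmetization -/

/-- A counting problem for tuples with `κ + 1` entries, each of which is encoded by `m` bits. The
constraints on the tuples are given by `pat`; the nodes claim that the number of valid tuples is
`aut` times their label, and reject if this exceeds `bound`. -/
structure Scheme where
  κ : ℕ
  m : ℕ
  pat : ℕ → ℕ → Bool → Bool
  aut : ℕ
  bound : ℕ

namespace Scheme

/-- The number of Boolean variables. -/
def T (A : Scheme) : ℕ := (A.κ + 1) * A.m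

/-- The number of messages of the prover. -/
def R (A : Scheme) : ℕ := A.T + A.κ + 2

end Scheme

section Arithmetization

variable {F : Type} [Field F] {n : ℕ}

/-- The multilinear extension of the indicator function of the binary expansion of `u`. -/
def chi (m u : ℕ) (x : ℕ → F) : F :=
  ∏ b ∈ range m, if u.testBit b then x b else 1 - x b

/-- The `i`-th block of `m` variables. -/
def block (m i : ℕ) (x : ℕ → F) : ℕ → F := fun b => x (i * m + b)

/-- The multilinear extension, in the `j`-th block, of the indicator function of the nodes `v` which
are compatible as `j`-th entry with the `i`-th entry `u`. -/
def rowExt (A : Scheme) (i j : ℕ) (u : Fin n) (nbr : Fin n → Bool) (x : ℕ → F) : F :=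
  ∑ v : Fin n, if u ≠ v ∧ A.pat i j (nbr v) = true then chi A.m v (block A.m j x) else 0

/-- The contribution of node `u` to the `i`-th factor. -/
def beta (A : Scheme) (i : ℕ) (u : Fin n) (nbr : Fin n → Bool) (x : ℕ → F) : F :=
  chi A.m u (block A.m i x) * ∏ j ∈ range i, rowExt A i j u nbr x

open Classical in
/-- The adjacency row of a node. -/
def adjRow (G : SimpleGraph (Fin n)) (u v : Fin n) : Bool := decide (G.Adj u v)

/-- The polynomial expressing the constraints between the `i`-th entry and its predecessors. -/
def factor (A : Scheme) (G : SimpleGraph (Fin n)) (i : ℕ) (x : ℕ → F) : F :=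
  ∑ u, beta A i u (adjRow G u) x

/-- The polynomial whose sum over the Boolean cube is the number of valid tuples. -/
def prodPoly (A : Scheme) (G : SimpleGraph (Fin n)) (x : ℕ → F) : F :=
  ∏ i ∈ range A.κ, factor A G (i + 1) x

lemma chi_congr {m u : ℕ} {x x' : ℕ → F} (h : ∀ b < m, x b = x' b) : chi m u x = chi m u x' :=
  Finset.prod_congr rfl fun b hb => by rw [h b (mem_range.1 hb)]

lemma chi_block_congr {M m u i : ℕ} {x x' : ℕ → F} (hM : (i + 1) * m ≤ M)
    (h : ∀ t < M, x t = x' t) : chi m u (block m i x) = chi m u (block m i x') :=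
  chi_congr fun b hb => h _ (by rw [add_mul] at hM; omega)

lemma beta_congr (A : Scheme) {i : ℕ} (hi : i ≤ A.κ) (u : Fin n) (nbr : Fin n → Bool)
    {x x' : ℕ → F} (h : ∀ t < A.T, x t = x' t) : beta A i u nbr x = beta A i u nbr x' := by
  have hle : ∀ j ≤ i, (j + 1) * A.m ≤ A.T := fun j hj => Nat.mul_le_mul_right _ (by omega)
  unfold beta rowExt
  congr 1
  · exact chi_block_congr (hle i le_rfl) h
  · refine Finset.prod_congr rfl fun j hj => Finset.sum_congr rfl fun v _ => ?_
    rw [chi_block_congr (hle j (mem_range.1 hj).le) h]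

lemma factor_congr (A : Scheme) (G : SimpleGraph (Fin n)) {i : ℕ} (hi : i ≤ A.κ)
    {x x' : ℕ → F} (h : ∀ t < A.T, x t = x' t) : factor A G i x = factor A G i x' :=
  Finset.sum_congr rfl fun u _ => beta_congr A hi u _ h

lemma prodPoly_congr (A : Scheme) (G : SimpleGraph (Fin n))
    (x x' : ℕ → F) (h : ∀ t < A.T, x t = x' t) : prodPoly A G x = prodPoly A G x' :=
  Finset.prod_congr rfl fun i hi => factor_congr A G (by have := mem_range.1 hi; omega) h

/-- The degree is kept as a count of the positions of block `i` that are the variable `t`, so that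
the counts of different blocks can be added. -/
lemma degLE_chi_block (m u i t : ℕ) :
    DegLE (∑ b ∈ range m, if i * m + b = t then 1 else 0) t
      fun x : ℕ → F => chi m u (block m i x) := by
  unfold chi block
  refine degLE_prod _ fun b _ => ?_
  by_cases h : u.testBit b
  · simp only [h, if_true]
    exact degLE_coord (F := F) t (i * m + b)
  · simp only [h]
    exact (degLE_const _ t 1).sub (degLE_coord (F := F) t (i * m + b))

/-- The factors of `beta` involve disjoint blocks of variables, and `t = j * m + b` with `b < m` has
at most one solution: the variable `t` lies in at most one block, where the expression is
multilinear. -/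
lemma degLE_beta (A : Scheme) (i t : ℕ) (u : Fin n) (nbr : Fin n → Bool) :
    DegLE 1 t fun x : ℕ → F => beta A i u nbr x := by
  unfold beta rowExt
  refine ((degLE_chi_block A.m u i t).mul (degLE_prod (range i)
    (d := fun j => ∑ b ∈ range A.m, if j * A.m + b = t then 1 else 0) fun j _ =>
      degLE_sum _ fun v _ => ?_)).mono ?_
  · split_ifs
    · exact degLE_chi_block A.m v j t
    · exact degLE_const _ t 0
  · rw [add_comm, ← Finset.sum_range_succ
      (fun j => ∑ b ∈ range A.m, if j * A.m + b = t then 1 else 0), ← Finset.sum_product',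
      ← Finset.card_filter, Finset.card_le_one]
    rintro ⟨a, b⟩ h1 ⟨c, d⟩ h2
    simp only [mem_filter, mem_product, mem_range] at h1 h2
    obtain ⟨⟨-, hb⟩, h1⟩ := h1
    obtain ⟨⟨-, hd⟩, h2⟩ := h2
    have hm : 0 < A.m := by omega
    have e1 : a = t / A.m := by
      rw [← h1, mul_comm, Nat.mul_add_div hm, Nat.div_eq_of_lt hb, add_zero]
    have e2 : c = t / A.m := by
      rw [← h2, mul_comm, Nat.mul_add_div hm, Nat.div_eq_of_lt hd, add_zero]
    obtain rfl : a = c := e1.trans e2.symm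
    rw [Prod.mk.injEq]
    exact ⟨rfl, by omega⟩

lemma degLE_prodPoly (A : Scheme) (G : SimpleGraph (Fin n)) (t : ℕ) :
    DegLE A.κ t fun x : ℕ → F => prodPoly A G x := by
  refine (degLE_prod (range A.κ) (d := fun _ => 1) fun i _ =>
    degLE_sum _ fun u _ => degLE_beta A (i + 1) t u (adjRow G u)).mono ?_
  simp

/-! ### The sum over the Boolean cube -/

lemma chi_bool (m u : ℕ) (y : ℕ → Bool) :
    chi m u (fun b => if y b then (1 : F) else 0) =
      if ∀ b < m, u.testBit b = y b then 1 else 0 := by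
  split_ifs with h
  · refine Finset.prod_eq_one fun b hb => ?_
    rw [h b (mem_range.1 hb)]
    cases hy : y b <;> simp [hy]
  · push Not at h
    obtain ⟨b, hb, hne⟩ := h
    refine Finset.prod_eq_zero (mem_range.2 hb) ?_
    cases hu : u.testBit b <;> cases hy : y b <;> simp_all

lemma testBit_inj {m u v : ℕ} (hu : u < 2 ^ m) (hv : v < 2 ^ m)
    (h : ∀ b < m, u.testBit b = v.testBit b) : u = v := by
  refine Nat.eq_of_testBit_eq fun b => ?_
  by_cases hb : b < m
  · exact h b hb
  · rw [Nat.testBit_lt_two_pow (hu.trans_le (Nat.pow_le_pow_right (by norm_num) (by omega))),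
      Nat.testBit_lt_two_pow (hv.trans_le (Nat.pow_le_pow_right (by norm_num) (by omega)))]

/-- The point of the Boolean cube given by a function. -/
def cubePoint (M : ℕ) (y : Fin M → Bool) : ℕ → F :=
  fun i => if h : i < M then (if y ⟨i, h⟩ then 1 else 0) else 0

lemma block_lt_T (A : Scheme) {i b : ℕ} (hi : i < A.κ + 1) (hb : b < A.m) :
    i * A.m + b < A.T := by
  have : (i + 1) * A.m ≤ A.T := Nat.mul_le_mul_right _ (by omega)
  rw [add_mul] at this
  omega

lemma chi_block_cubePoint (A : Scheme) (y : Fin A.T → Bool) {i : ℕ} (hi : i < A.κ + 1) (u : ℕ) :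
    chi A.m u (block A.m i (cubePoint (F := F) A.T y)) =
      if ∀ (b : ℕ) (hb : b < A.m), u.testBit b = y ⟨i * A.m + b, block_lt_T A hi hb⟩
        then 1 else 0 := by
  rw [chi_congr (x' := fun b => if (if h : i * A.m + b < A.T then y ⟨_, h⟩ else false)
    then 1 else 0), chi_bool]
  · congr 1
    refine propext (forall_congr' fun b => forall_congr' fun hb => ?_)
    rw [dif_pos (block_lt_T A hi hb)]
  · intro b hb
    simp [block, cubePoint, block_lt_T A hi hb]

/-- The encoding of a tuple by bits. -/
def tupleCode (A : Scheme) (φ : Fin (A.κ + 1) → Fin n) : Fin A.T → Bool := fun t =>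
  (φ ⟨t / A.m, Nat.div_lt_of_lt_mul (by rw [mul_comm]; exact t.2)⟩ : ℕ).testBit (t % A.m)

lemma tupleCode_apply (A : Scheme) (φ : Fin (A.κ + 1) → Fin n) {i b : ℕ} (hi : i < A.κ + 1)
    (hb : b < A.m) (h : i * A.m + b < A.T) :
    tupleCode A φ ⟨i * A.m + b, h⟩ = (φ ⟨i, hi⟩ : ℕ).testBit b := by
  have e1 : (i * A.m + b) / A.m = i := by
    rw [mul_comm, Nat.mul_add_div (by omega), Nat.div_eq_of_lt hb, add_zero]
  have e2 : (i * A.m + b) % A.m = b := by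
    rw [mul_comm, Nat.mul_add_mod, Nat.mod_eq_of_lt hb]
  simp only [tupleCode, e1, e2]

lemma chi_block_tupleCode (A : Scheme) (hn : n ≤ 2 ^ A.m) (φ : Fin (A.κ + 1) → Fin n) {i : ℕ}
    (hi : i < A.κ + 1) (u : Fin n) :
    chi A.m u (block A.m i (cubePoint (F := F) A.T (tupleCode A φ))) =
      if u = φ ⟨i, hi⟩ then 1 else 0 := by
  rw [chi_block_cubePoint A _ hi]
  congr 1
  refine propext ⟨fun h => ?_, fun h b hbm => ?_⟩
  · refine Fin.ext (testBit_inj (u.2.trans_le hn) ((φ ⟨i, hi⟩).2.trans_le hn) fun b hb => ?_)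
    rw [h b hb, tupleCode_apply A φ hi hb]
  · rw [h, tupleCode_apply A φ hi hbm]

lemma tupleCode_injective (A : Scheme) (hn : n ≤ 2 ^ A.m) :
    Injective (tupleCode A : (Fin (A.κ + 1) → Fin n) → _) := by
  intro φ ψ h
  funext i
  refine Fin.ext (testBit_inj ((φ i).2.trans_le hn) ((ψ i).2.trans_le hn) fun b hb => ?_)
  have := congrFun h ⟨i * A.m + b, block_lt_T A i.2 hb⟩
  rwa [tupleCode_apply A φ i.2 hb, tupleCode_apply A ψ i.2 hb] at this

/-- At the code of a tuple every `chi` is a Kronecker delta, so each sum over nodes collapses to the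
entry of the tuple, and what remains is the product of the indicators of the constraints. -/
lemma prodPoly_tupleCode (A : Scheme) (hn : n ≤ 2 ^ A.m) (G : SimpleGraph (Fin n))
    (φ : Fin (A.κ + 1) → Fin n)
    [Decidable (∀ i j : Fin (A.κ + 1), j < i →
      φ i ≠ φ j ∧ A.pat i j (adjRow G (φ i) (φ j)) = true)] :
    prodPoly A G (cubePoint (F := F) A.T (tupleCode A φ)) =
      if ∀ i j : Fin (A.κ + 1), j < i → φ i ≠ φ j ∧ A.pat i j (adjRow G (φ i) (φ j)) = true
        then 1 else 0 := by
  classical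
  have hrow : ∀ (i j : ℕ) (hj : j < A.κ + 1) (u : Fin n),
      rowExt A i j u (adjRow G u) (cubePoint (F := F) A.T (tupleCode A φ)) =
        if u ≠ φ ⟨j, hj⟩ ∧ A.pat i j (adjRow G u (φ ⟨j, hj⟩)) = true then 1 else 0 := by
    intro i j hj u
    unfold rowExt
    rw [Finset.sum_eq_single (φ ⟨j, hj⟩)]
    · rw [chi_block_tupleCode A hn φ hj, if_pos rfl]
    · intro v _ hv
      rw [chi_block_tupleCode A hn φ hj, if_neg hv, ite_self]
    · simp
  have hfac : ∀ (i : ℕ) (hi : i < A.κ + 1),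
      factor A G i (cubePoint (F := F) A.T (tupleCode A φ)) =
        ∏ j ∈ range i, rowExt A i j (φ ⟨i, hi⟩) (adjRow G (φ ⟨i, hi⟩))
          (cubePoint (F := F) A.T (tupleCode A φ)) := by
    intro i hi
    unfold factor beta
    rw [Finset.sum_eq_single (φ ⟨i, hi⟩)]
    · rw [chi_block_tupleCode A hn φ hi, if_pos rfl, one_mul]
    · intro v _ hv
      rw [chi_block_tupleCode A hn φ hi, if_neg hv, zero_mul]
    · simp
  split_ifs with h
  · refine Finset.prod_eq_one fun i hi => ?_
    have hi' : i + 1 < A.κ + 1 := by have := mem_range.1 hi; omega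
    rw [hfac _ hi']
    refine Finset.prod_eq_one fun j hj => ?_
    have hj' := mem_range.1 hj
    rw [hrow _ j (by omega), if_pos]
    exact h ⟨i + 1, hi'⟩ ⟨j, by omega⟩ (Fin.mk_lt_mk.2 hj')
  · push Not at h
    obtain ⟨i, j, hij, hne⟩ := h
    have hij' : (j : ℕ) < i := hij
    have hi := i.2
    refine Finset.prod_eq_zero (i := (i : ℕ) - 1) (mem_range.2 (by omega)) ?_
    have hi1 : (i : ℕ) - 1 + 1 = i := by omega
    rw [hi1, hfac _ hi]
    refine Finset.prod_eq_zero (i := (j : ℕ)) (mem_range.2 hij') ?_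
    rw [hrow _ _ j.2, if_neg]
    exact fun hc => hne hc.1 hc.2

/-- Some block of such a point is the code of no node (`2 ^ m` may exceed `n`), so all its `chi`
vanish. A block `i > 0` kills the factor with number `i`. Block `0` has no factor of its own, but
occurs as a predecessor in the factor with number `1`, which exists because `κ > 0`. -/
lemma prodPoly_eq_zero (A : Scheme) (hκ : 0 < A.κ) (G : SimpleGraph (Fin n)) (y : Fin A.T → Bool)
    (hy : ∀ φ : Fin (A.κ + 1) → Fin n, tupleCode A φ ≠ y) :
    prodPoly A G (cubePoint (F := F) A.T y) = 0 := by
  have : ∃ i : Fin (A.κ + 1), ∀ u : Fin n,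
      chi A.m u (block A.m i (cubePoint (F := F) A.T y)) = 0 := by
    by_contra hcon
    push Not at hcon
    choose φ hφ using hcon
    refine hy φ ?_
    funext t
    have hm : 0 < A.m := by
      rcases Nat.eq_zero_or_pos A.m with h | h
      · have := t.2
        simp [Scheme.T, h] at this
      · exact h
    have hi : (t : ℕ) / A.m < A.κ + 1 := Nat.div_lt_of_lt_mul (by rw [mul_comm]; exact t.2)
    have hb : (t : ℕ) % A.m < A.m := Nat.mod_lt _ hm
    have ht : (t : ℕ) / A.m * A.m + t % A.m = t := by rw [mul_comm]; exact Nat.div_add_mod _ _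
    have h1 := hφ ⟨_, hi⟩
    rw [chi_block_cubePoint A y hi] at h1
    have h2 := (ite_ne_right_iff.1 h1).1 _ hb
    have h3 := tupleCode_apply A φ hi hb (block_lt_T A hi hb)
    rw [h2] at h3
    have h4 : (⟨(t : ℕ) / A.m * A.m + t % A.m, block_lt_T A hi hb⟩ : Fin A.T) = t := Fin.ext ht
    rwa [h4] at h3
  obtain ⟨i, hi⟩ := this
  rcases Nat.eq_zero_or_pos (i : ℕ) with h0 | h0
  · refine Finset.prod_eq_zero (i := 0) (mem_range.2 hκ) (Finset.sum_eq_zero fun u _ => ?_)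
    unfold beta
    rw [Finset.prod_eq_zero (i := 0) (by simp), mul_zero]
    unfold rowExt
    refine Finset.sum_eq_zero fun v _ => ?_
    have := hi v
    rw [h0] at this
    rw [this, ite_self]
  · have h1 : (i : ℕ) - 1 + 1 = i := by omega
    have := i.2
    refine Finset.prod_eq_zero (i := (i : ℕ) - 1) (mem_range.2 (by omega))
      (Finset.sum_eq_zero fun u _ => ?_)
    unfold beta
    rw [h1, hi u, zero_mul]

/-- The sum of the arithmetization over the Boolean cube is the number of valid tuples. -/
lemma cubeSum_prodPoly (A : Scheme) (hκ : 0 < A.κ) (hn : n ≤ 2 ^ A.m) (G : SimpleGraph (Fin n))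
    (x : ℕ → F) :
    cubeSum (prodPoly A G) 0 A.T x = (tupleCount A.pat (A.κ + 1) G : F) := by
  classical
  -- All variables that `prodPoly` reads are summed over, so the base point may be taken to be zero.
  rw [cubeSum_congr (prodPoly_congr A G) A.T 0 (by omega) x (fun _ => 0) (by simp),
    cubeSum_eq_sum]
  have e : ∀ y : Fin A.T → Bool, (fun i => if h : 0 ≤ i ∧ i - 0 < A.T then
      (if y ⟨i - 0, h.2⟩ then (1 : F) else 0) else 0) = cubePoint A.T y := by
    intro y
    funext i
    simp [cubePoint]
  simp only [e]
  rw [← Fintype.sum_of_injective (tupleCode A) (tupleCode_injective A hn)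
    (fun φ : Fin (A.κ + 1) → Fin n => if ∀ i j : Fin (A.κ + 1), j < i →
      φ i ≠ φ j ∧ A.pat i j (adjRow G (φ i) (φ j)) = true then (1 : F) else 0)]
  · rw [tupleCount, Finset.sum_boole]
    unfold adjRow
    congr!
  · intro y hy
    exact prodPoly_eq_zero A hκ G y fun φ h => hy ⟨φ, h⟩
  · intro φ
    exact (prodPoly_tupleCode A hn G φ).symm

end Arithmetization

/-! ### The polynomials of the sumcheck protocol -/

section Sumcheck

variable {F : Type} [Field F] {n : ℕ}

/-- The univariate function that the prover has to send in round `t`, at the point `x`. In the last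
round `t = T` the factors are randomized by the masks `μ`. -/
def roundFun (A : Scheme) (G : SimpleGraph (Fin n)) (μ : ℕ → F) (t : ℕ) (x : ℕ → F) (z : F) : F :=
  if t < A.T then cubeSum (prodPoly A G) (t + 1) (A.T - t - 1) (update x t z)
  else ∏ i ∈ range A.κ, (factor A G (i + 1) x + z * μ i)

/-- The combination of the values of the function of round `t` that is compared with the value of
the previous function. -/
def chk (A : Scheme) (t : ℕ) (g : F → F) : F := g 0 + if t < A.T then g 1 else 0

/-- In both kinds of rounds the degree is at most the number `κ` of factors, so `κ < n` leaves one
coefficient per node. -/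
lemma roundFun_coeffs (A : Scheme) (hn : A.κ < n) (G : SimpleGraph (Fin n)) (μ : ℕ → F) (t : ℕ)
    (x : ℕ → F) : ∃ c : Fin n → F, ∀ z, roundFun A G μ t x z = ∑ j, c j * z ^ (j : ℕ) := by
  by_cases ht : t < A.T
  · obtain ⟨p, hp, he⟩ :=
      (degLE_prodPoly (F := F) A G t).cubeSum (A.T - t - 1) (t + 1) (by omega) x
    refine exists_coeffs hn p hp fun z => ?_
    rw [roundFun, if_pos ht, he]
  · refine exists_coeffs hn
      (∏ i ∈ range A.κ, (Polynomial.C (factor A G (i + 1) x) + Polynomial.X * Polynomial.C (μ i)))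
      ?_ fun z => ?_
    · refine (Polynomial.natDegree_prod_le _ _).trans ((Finset.sum_le_card_nsmul _ _ 1 ?_).trans ?_)
      · intro i _
        compute_degree
      · simp
    · rw [roundFun, if_neg ht, Polynomial.eval_prod]
      simp [mul_comm z]

lemma chk_roundFun_zero (A : Scheme) (hκ : 0 < A.κ) (hn : n ≤ 2 ^ A.m) (hT : 0 < A.T)
    (G : SimpleGraph (Fin n)) (μ : ℕ → F) (x : ℕ → F) :
    chk A 0 (roundFun A G μ 0 x) = (tupleCount A.pat (A.κ + 1) G : F) := by
  rw [← cubeSum_prodPoly A hκ hn G x]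
  obtain ⟨d, hd⟩ : ∃ d, A.T = d + 1 := ⟨A.T - 1, by omega⟩
  simp only [chk, roundFun, hT, if_true]
  rw [hd]
  simp [cubeSum]

/-- Before round `T` this is the splitting of a partial sum by its first variable. The step into
round `T` has no variable left to sum: `chk` only evaluates at `0`, where the masks disappear and
the product of the factors remains. -/
lemma chk_roundFun_succ (A : Scheme) (G : SimpleGraph (Fin n)) (μ : ℕ → F) {t : ℕ} (ht : t < A.T)
    (x : ℕ → F) : chk A (t + 1) (roundFun A G μ (t + 1) x) = roundFun A G μ t x (x t) := by
  rw [roundFun, if_pos ht, update_eq_self]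
  by_cases h : t + 1 < A.T
  · simp only [chk, roundFun, h, if_true]
    obtain ⟨d, hd⟩ : ∃ d, A.T - t - 1 = d + 1 := ⟨A.T - t - 2, by omega⟩
    rw [hd, show A.T - (t + 1) - 1 = d by omega]
    simp [cubeSum]
  · simp only [chk, roundFun, h, if_false]
    rw [show A.T - t - 1 = 0 by omega]
    simp [cubeSum, prodPoly]

lemma roundFun_last (A : Scheme) (G : SimpleGraph (Fin n)) (μ : ℕ → F) (x : ℕ → F) (z : F) :
    roundFun A G μ A.T x z = ∏ i ∈ range A.κ, (factor A G (i + 1) x + z * μ i) := by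
  simp [roundFun]

/-- Causality of the ideal polynomials: round `t` depends only on the first `t` coordinates, and on
the masks only from round `T` on. It is needed both for soundness and to see that the honest prover
can compute its messages in time. -/
lemma roundFun_congr (A : Scheme) (G : SimpleGraph (Fin n)) {μ μ' : ℕ → F} {t : ℕ}
    {x x' : ℕ → F} (hx : ∀ i < t, x i = x' i) (hμ : A.T ≤ t → ∀ i < A.κ, μ i = μ' i) (z : F) :
    roundFun A G μ t x z = roundFun A G μ' t x' z := by
  unfold roundFun
  split_ifs with h
  · refine cubeSum_congr (prodPoly_congr A G) _ _ (by omega) _ _ fun i hi => ?_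
    rcases eq_or_ne i t with rfl | hit
    · simp
    · simp only [update_of_ne hit]
      exact hx i (by omega)
  · refine Finset.prod_congr rfl fun i hi => ?_
    have := mem_range.1 hi
    rw [factor_congr A G (by omega) fun i hi => hx i (by omega), hμ (by omega) i this]

end Sumcheck

/-! ### The equations checked by the nodes -/

section Equations

variable {F : Type} [Field F] {n : ℕ}

open Classical in
/-- A nonzero element that equals `z` if possible. -/
def nz (z : F) : F := if z = 0 then 1 else z

lemma nz_ne_zero (z : F) : nz z ≠ 0 := by
  unfold nz
  split_ifs with h
  · exact one_ne_zero
  · exact h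

/-- The sequence of the messages of the prover to one node. Each consists of the last public coin,
two shares of a coefficient, a share of a mask, a masked factor and an element which is the mask of
the node in the first message and the sum over its subtree in the last message. -/
abbrev Messages (F : Type) : Type := ℕ → Fin 6 → F

/-- The value at `z` of the part of the polynomial of round `t` that is known to node `u`. -/
def piece (u : Fin n) (D : Messages F) (t : ℕ) (z : F) : F :=
  D t 1 * z ^ (u : ℕ) + D t 2 * z ^ (finRotate n u : ℕ)

/-- The masked factors. -/
def maskedFactor (A : Scheme) (D : Messages F) (i : ℕ) : F := D (A.T + 1 + i) 4

/-- The point at which the polynomial of round `t` is evaluated. -/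
def evalPoint (A : Scheme) (c : ℕ → F) (t : ℕ) : F :=
  if t < A.T then c (t + 1) else nz (c (A.T + 1))

/-- The contribution of node `u` to the `j`-th equation, if the public coins are `c`. -/
def eqn (A : Scheme) (c : ℕ → F) (claim : F) (u : Fin n) (nbr : Fin n → Bool) (D : Messages F)
    (j : ℕ) : F :=
  if j = 0 then chk A 0 (piece u D 0) - if (u : ℕ) = 0 then claim else 0
  else if j ≤ A.T then chk A j (piece u D j) - piece u D (j - 1) (c j)
  else if j = A.T + 1 then piece u D A.T (nz (c (A.T + 1))) -
    if (u : ℕ) = 0 then ∏ i ∈ range A.κ, maskedFactor A D i else 0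
  else beta A (j - A.T - 2 + 1) u nbr (fun t => c (t + 1)) + nz (c (A.T + 1)) * D (j - A.T - 2) 3 -
    if (u : ℕ) = 0 then maskedFactor A D (j - A.T - 2) else 0

/-- The sum of the equations of node `u`, weighted by powers of the last coin. -/
def localSum (A : Scheme) (c : ℕ → F) (claim : F) (u : Fin n) (nbr : Fin n → Bool)
    (D : Messages F) : F :=
  ∑ j ∈ range A.R, c (A.R - 1) ^ (j + 1) * eqn A c claim u nbr D j

/-- The polynomial of round `t` that is shared by the nodes. -/
def sharedFun (D : Fin n → Messages F) (t : ℕ) (z : F) : F := ∑ u, piece u (D u) t z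

/-- Whatever the prover sends, the shares define a polynomial of degree less than `n`, so no degree
test is needed. Coefficient `j` is the sum of the first share of node `j` and the second share of
its predecessor under the rotation. -/
lemma sharedFun_coeffs (D : Fin n → Messages F) (t : ℕ) :
    ∃ c : Fin n → F, ∀ z, sharedFun D t z = ∑ j, c j * z ^ (j : ℕ) := by
  refine ⟨fun j => D j t 1 + D ((finRotate n).symm j) t 2, fun z => ?_⟩
  simp only [sharedFun, piece, Finset.sum_add_distrib, add_mul]
  congr 1
  rw [← Equiv.sum_comp (finRotate n) fun j => D ((finRotate n).symm j) t 2 * z ^ (j : ℕ)]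
  simp only [Equiv.symm_apply_apply]

lemma sum_chk (A : Scheme) (D : Fin n → Messages F) (j t : ℕ) :
    ∑ u, chk A j (piece u (D u) t) = chk A j (sharedFun D t) := by
  unfold chk sharedFun
  split_ifs <;> simp [Finset.sum_add_distrib]

lemma sum_eqn_succ (A : Scheme) (c : ℕ → F) (claim : Fin n → F) (nbr : Fin n → Fin n → Bool)
    (D : Fin n → Messages F) {j : ℕ} (hj : j < A.T) :
    ∑ u, eqn A c (claim u) u (nbr u) (D u) (j + 1) =
      chk A (j + 1) (sharedFun D (j + 1)) - sharedFun D j (c (j + 1)) := by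
  have h : j + 1 ≤ A.T := hj
  simp only [eqn, Nat.succ_ne_zero, if_false, h, if_true, Finset.sum_sub_distrib, sum_chk,
    Nat.add_sub_cancel]
  rfl

variable [NeZero n]

lemma sum_ite_root (f : Fin n → F) :
    ∑ u : Fin n, (if (u : ℕ) = 0 then f u else 0) = f 0 := by
  rw [Finset.sum_eq_single 0]
  · simp
  · intro u _ hu
    rw [if_neg]
    exact fun h => hu (Fin.ext h)
  · simp

lemma sum_eqn_zero (A : Scheme) (c : ℕ → F) (claim : Fin n → F) (nbr : Fin n → Fin n → Bool)
    (D : Fin n → Messages F) :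
    ∑ u, eqn A c (claim u) u (nbr u) (D u) 0 = chk A 0 (sharedFun D 0) - claim 0 := by
  simp only [eqn, if_true, Finset.sum_sub_distrib, sum_chk, sum_ite_root]

lemma sum_eqn_last (A : Scheme) (c : ℕ → F) (claim : Fin n → F) (nbr : Fin n → Fin n → Bool)
    (D : Fin n → Messages F) :
    ∑ u, eqn A c (claim u) u (nbr u) (D u) (A.T + 1) =
      sharedFun D A.T (nz (c (A.T + 1))) - ∏ i ∈ range A.κ, maskedFactor A (D 0) i := by
  have h : ¬ A.T + 1 ≤ A.T := by omega
  simp only [eqn, Nat.succ_ne_zero, if_false, h, if_true, Finset.sum_sub_distrib]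
  rw [sum_ite_root fun u => ∏ i ∈ range A.κ, maskedFactor A (D u) i]
  rfl

lemma sum_eqn_factor (A : Scheme) (G : SimpleGraph (Fin n)) (c : ℕ → F) (claim : Fin n → F)
    (D : Fin n → Messages F) (i : ℕ) :
    ∑ u, eqn A c (claim u) u (adjRow G u) (D u) (A.T + 2 + i) =
      factor A G (i + 1) (fun t => c (t + 1)) + nz (c (A.T + 1)) * ∑ u, D u i 3 -
        maskedFactor A (D 0) i := by
  have h0 : ¬ A.T + 2 + i = 0 := by omega
  have h1 : ¬ A.T + 2 + i ≤ A.T := by omega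
  have h2 : ¬ A.T + 2 + i = A.T + 1 := by omega
  have h3 : A.T + 2 + i - A.T - 2 = i := by omega
  simp only [eqn, h0, h1, h2, h3, if_false, Finset.sum_sub_distrib, Finset.sum_add_distrib,
    ← Finset.mul_sum]
  rw [sum_ite_root fun u => maskedFactor A (D u) i]
  rfl

/-- The masks `μ` shared by the nodes. -/
def sharedMask (D : Fin n → Messages F) (i : ℕ) : F := ∑ u, D u i 3

/-- The polynomial of round `t` is not the right one, but has the right value at the point at which
it is evaluated. -/
def BadRound (A : Scheme) (G : SimpleGraph (Fin n)) (c : ℕ → F) (D : Fin n → Messages F) (t : ℕ) :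
    Prop :=
  (∃ z, sharedFun D t z ≠ roundFun A G (sharedMask D) t (fun i => c (i + 1)) z) ∧
    sharedFun D t (evalPoint A c t) =
      roundFun A G (sharedMask D) t (fun i => c (i + 1)) (evalPoint A c t)

/-- If all equations hold and no round is bad then the claim is correct. -/
lemma claim_eq_of_eqns (A : Scheme) (hκ : 0 < A.κ) (hn : n ≤ 2 ^ A.m) (hT : 0 < A.T)
    (G : SimpleGraph (Fin n)) (c : ℕ → F) (claim : Fin n → F) (D : Fin n → Messages F)
    (h : ∀ j < A.R, ∑ u, eqn A c (claim u) u (adjRow G u) (D u) j = 0)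
    (hbad : ∀ t ≤ A.T, ¬ BadRound A G c D t) :
    claim 0 = (tupleCount A.pat (A.κ + 1) G : F) := by
  by_contra hne
  set x : ℕ → F := fun i => c (i + 1) with hx
  have hR : A.R = A.T + A.κ + 2 := rfl
  -- The error propagates: a wrong claim makes the polynomial of round `0` wrong, and since round
  -- `t` is not bad, its polynomial also has a wrong value at the next coin, which the polynomial of
  -- round `t + 1` has to match.
  have key : ∀ t ≤ A.T, ∃ z, sharedFun D t z ≠ roundFun A G (sharedMask D) t x z := by
    intro t
    induction t with
    | zero =>
      intro _
      by_contra hcon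
      push Not at hcon
      have h0 := h 0 (by omega)
      rw [sum_eqn_zero, funext hcon, chk_roundFun_zero A hκ hn hT, sub_eq_zero] at h0
      exact hne h0.symm
    | succ t ih =>
      intro ht
      by_contra hcon
      push Not at hcon
      have h0 := h (t + 1) (by omega)
      rw [sum_eqn_succ A c claim _ D (by omega), funext hcon, chk_roundFun_succ A G _ (by omega),
        sub_eq_zero] at h0
      refine hbad t (by omega) ⟨ih (by omega), ?_⟩
      rw [evalPoint, if_pos (by omega)]
      exact h0.symm
  have hlast := h (A.T + 1) (by omega)
  rw [sum_eqn_last, sub_eq_zero] at hlast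
  -- The equations for the masked factors force the right value in round `T`, although the
  -- polynomial is wrong: a bad round.
  refine hbad A.T le_rfl ⟨key A.T le_rfl, ?_⟩
  rw [evalPoint, if_neg (lt_irrefl _), hlast, roundFun_last]
  refine Finset.prod_congr rfl fun i hi => ?_
  have := mem_range.1 hi
  have h2 := h (A.T + 2 + i) (by omega)
  rw [sum_eqn_factor, sub_eq_zero] at h2
  exact h2.symm

/-- All equations hold if the prover follows the protocol and the claim is correct. -/
lemma eqns_of_honest (A : Scheme) (hκ : 0 < A.κ) (hn : n ≤ 2 ^ A.m) (hT : 0 < A.T)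
    (G : SimpleGraph (Fin n)) (c : ℕ → F) (claim : Fin n → F) (D : Fin n → Messages F)
    (hclaim : claim 0 = (tupleCount A.pat (A.κ + 1) G : F))
    (hD : ∀ t ≤ A.T, ∀ z,
      sharedFun D t z = roundFun A G (sharedMask D) t (fun i => c (i + 1)) z)
    (hy : ∀ i < A.κ, maskedFactor A (D 0) i =
      factor A G (i + 1) (fun t => c (t + 1)) + nz (c (A.T + 1)) * sharedMask D i) :
    ∀ j < A.R, ∑ u, eqn A c (claim u) u (adjRow G u) (D u) j = 0 := by
  intro j hj
  have hR : A.R = A.T + A.κ + 2 := rfl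
  rcases Nat.eq_zero_or_pos j with rfl | h0
  · rw [sum_eqn_zero, funext (hD 0 (by omega)), chk_roundFun_zero A hκ hn hT, hclaim, sub_self]
  by_cases h1 : j ≤ A.T
  · obtain ⟨t, rfl⟩ : ∃ t, j = t + 1 := ⟨j - 1, by omega⟩
    rw [sum_eqn_succ A c claim _ D (by omega), funext (hD (t + 1) h1),
      chk_roundFun_succ A G _ (by omega), hD t (by omega), sub_self]
  by_cases h2 : j = A.T + 1
  · rw [h2, sum_eqn_last, hD A.T le_rfl, roundFun_last, sub_eq_zero]
    exact Finset.prod_congr rfl fun i hi => (hy i (mem_range.1 hi)).symm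
  · obtain ⟨i, rfl⟩ : ∃ i, j = A.T + 2 + i := ⟨j - A.T - 2, by omega⟩
    rw [sum_eqn_factor, hy i (by omega)]
    exact sub_self _

end Equations

/-! ### The verifier -/

section Verifier

variable {F : Type} [Field F] {n ℓ b : ℕ}

/-- An encoding of `w` field elements by `ℓ` bits. -/
structure Codec (F : Type) (ℓ w : ℕ) where
  enc : (Fin w → F) → Msg ℓ
  dec : Msg ℓ → Fin w → F
  dec_enc : ∀ x, dec (enc x) = x

lemma exists_codec {F : Type} [Fintype F] [Nonempty F] {s w : ℕ} (h : Fintype.card F ≤ 2 ^ s) :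
    Nonempty (Codec F (w * s) w) := by
  classical
  have hcard : Fintype.card (Fin w → F) ≤ Fintype.card (Msg (w * s)) := by
    simp only [Fintype.card_pi, Finset.prod_const, Finset.card_univ, Fintype.card_fin,
      Fintype.card_bool]
    rw [mul_comm, pow_mul]
    exact Nat.pow_le_pow_left h w
  obtain ⟨e⟩ := Function.Embedding.nonempty_of_card_le hcard
  exact ⟨⟨e, invFun e, leftInverse_invFun e.injective⟩⟩

/-- A finite sequence of coins, continued by zeros. -/
def coinAt {R : ℕ} (c : Fin R → F) (t : ℕ) : F := if h : t < R then c ⟨t, h⟩ else 0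

/-- The field elements contained in a list of messages. -/
def decodeList (C : Codec F ℓ 6) (L : List (Msg ℓ)) : Messages F :=
  fun t => if h : t < L.length then C.dec L[t] else 0

/-- The polynomial with the coefficients given by the public coins at the last coin. -/
def fingerprint (A : Scheme) (D : Messages F) : F :=
  ∑ t ∈ range (A.R - 1), D t 0 * D (A.R - 1) 0 ^ t

/-- The message of a node to its neighbour `v` in the verification phase. -/
def nodeMsg (A : Scheme) (inp : LocalInput n ℕ) (D : Messages F) (v : Fin n) : Fin 4 → F :=
  ![if v = inp.parent then D (A.R - 1) 5 else 0, D (A.R - 1) 0, fingerprint A D,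
    ((inp.label * A.aut : ℕ) : F)]

/-- The condition under which a node accepts. -/
structure NodeAccepts (A : Scheme) (inp : LocalInput n ℕ) (coin : ℕ → F) (D : Messages F)
    (inbox : Fin n → Option (Fin 4 → F)) : Prop where
  label_le : inp.label * A.aut ≤ A.bound
  root_coin : (inp.id : ℕ) = 0 → ∀ t < A.R, D t 0 = coin t
  root_sum : (inp.id : ℕ) = 0 → D (A.R - 1) 5 = 0
  nbr_coin : ∀ u x, inbox u = some x → x 1 = D (A.R - 1) 0
  nbr_fingerprint : ∀ u x, inbox u = some x → x 2 = fingerprint A D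
  nbr_label : ∀ u x, inbox u = some x → x 3 = ((inp.label * A.aut : ℕ) : F)
  sum_eq : D (A.R - 1) 5 = D 0 5 + localSum A (fun t => D t 0) ((inp.label * A.aut : ℕ) : F) inp.id
    (fun u => (inbox u).isSome) D + ∑ u, ((inbox u).map (· 0)).getD 0

open Classical in
/-- The verifier: the coins of the root are public, the other coins are not used. -/
def verifier (n : ℕ) [Fintype F] (A : Scheme) (C : Codec F ℓ 6) (C' : Codec F b 4) :
    Verifier n ℓ b ℕ where
  Coin := Fin A.R → F
  respond inp coin L := C.enc fun _ => if (inp.id : ℕ) = 0 then coinAt coin L.length else 0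
  verify :=
    { send := fun d _ v => C'.enc (nodeMsg A d.1 (decodeList C d.2.2) v)
      out := fun d L => decide (NodeAccepts A d.1 (coinAt d.2.1) (decodeList C d.2.2)
        fun u => (L.headD (fun _ => none) u).map C'.dec) }

/-- The transcript when the answers of the nodes depend only on the number of the round. -/
lemma interact_eq {Λ : Type} (V : Verifier n ℓ b Λ) (P : Prover n ℓ) (N : Network n Λ) (R : ℕ)
    (ω : Randomness V P) (resp : ℕ → Fin n → Msg ℓ)
    (hresp : ∀ v L, V.respond (N.input v) (ω.2 v) L = resp L.length v) :
    ∀ j ≤ R, interact V P N (2 * R) ω (2 * j) =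
      ⟨fun v => (List.range j).map fun t => P.strategy ω.1 ((List.range (t + 1)).map resp) v,
        (List.range j).map resp⟩ := by
  intro j
  induction j with
  | zero => intro _; simp [interact]
  | succ j ih =>
    intro hj
    -- With `2 * R` rounds in all, the rounds with even number belong to the nodes. So coin `t`
    -- reaches the prover just before its message `t`.
    have h1 : ¬ Odd (2 * R - 2 * j) := by
      rw [Nat.not_odd_iff_even]
      exact ⟨R - j, by omega⟩
    have h2 : Odd (2 * R - (2 * j + 1)) := ⟨R - j - 1, by omega⟩
    have hstep : interact V P N (2 * R) ω (2 * j + 1) =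
        ⟨fun v => (List.range j).map fun t => P.strategy ω.1 ((List.range (t + 1)).map resp) v,
          (List.range (j + 1)).map resp⟩ := by
      rw [interact, ih (by omega), if_neg h1]
      simp only [hresp, List.length_map, List.length_range, List.range_succ, List.map_append,
        List.map_cons, List.map_nil]
    rw [show 2 * (j + 1) = 2 * j + 1 + 1 by ring, interact, hstep, if_pos h2]
    simp only [List.range_succ, List.map_append, List.map_cons, List.map_nil]

/-- The answers of the nodes in round `t`. -/
def respAt (C : Codec F ℓ 6) (c : ℕ → F) (t : ℕ) : Fin n → Msg ℓ :=
  fun v => C.enc fun _ => if (v : ℕ) = 0 then c t else 0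

/-- The messages sent by a prover if the public coins are `c`. -/
def messagesOf (A : Scheme) (C : Codec F ℓ 6) (P : Prover n ℓ) (seed : P.Seed) (c : ℕ → F) :
    Fin n → Messages F := fun v t =>
  if t < A.R then C.dec (P.strategy seed ((List.range (t + 1)).map (respAt C c)) v) else 0

/-- Message `t` cannot depend on coins drawn after it; every soundness estimate rests on this. -/
lemma messagesOf_congr (A : Scheme) (C : Codec F ℓ 6) (P : Prover n ℓ) (seed : P.Seed)
    {c c' : ℕ → F} {t : ℕ} (h : ∀ i ≤ t, c i = c' i) (v : Fin n) :
    messagesOf A C P seed c v t = messagesOf A C P seed c' v t := by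
  unfold messagesOf
  have : (List.range (t + 1)).map (respAt (n := n) C c) =
      (List.range (t + 1)).map (respAt C c') := by
    refine List.map_congr_left fun i hi => ?_
    unfold respAt
    rw [h i (by rw [List.mem_range] at hi; omega)]
  rw [this]

variable [NeZero n] [Fintype F]

lemma toNode_eq (A : Scheme) (C : Codec F ℓ 6) (C' : Codec F b 4) (P : Prover n ℓ)
    (N : Network n ℕ) (ω : Randomness (verifier n A C C') P) (v : Fin n) :
    (interact (verifier n A C C') P N (2 * A.R) ω (2 * A.R)).toNode v =
      (List.range A.R).map fun t =>
        P.strategy ω.1 ((List.range (t + 1)).map (respAt C (coinAt (ω.2 0)))) v := by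
  rw [interact_eq (verifier n A C C') P N A.R ω (respAt C (coinAt (ω.2 0))) _ A.R le_rfl]
  intro v L
  simp only [verifier, respAt, Network.input]
  congr 1
  funext _
  split_ifs with h
  · rw [show v = 0 from Fin.ext h]
  · rfl

lemma decodeList_toNode (A : Scheme) (C : Codec F ℓ 6) (C' : Codec F b 4) (P : Prover n ℓ)
    (N : Network n ℕ) (ω : Randomness (verifier n A C C') P) (v : Fin n) :
    decodeList C ((interact (verifier n A C C') P N (2 * A.R) ω (2 * A.R)).toNode v) =
      messagesOf A C P ω.1 (coinAt (ω.2 0)) v := by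
  rw [toNode_eq]
  funext t
  simp [decodeList, messagesOf]

open Classical in
lemma received_verifier (A : Scheme) (C : Codec F ℓ 6) (C' : Codec F b 4) (P : Prover n ℓ)
    (N : Network n ℕ) (ω : Randomness (verifier n A C C') P) (v : Fin n) :
    (verifier n A C C').verify.received N.graph
        (verifyInput (verifier n A C C') P N (2 * A.R) ω) 1 v =
      [fun u => if N.graph.Adj u v then
        some (C'.enc (nodeMsg A (N.input u) (messagesOf A C P ω.1 (coinAt (ω.2 0)) u) v))
        else none] := by
  simp only [LocalAlg.received, List.nil_append]
  congr 1
  funext u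
  split_ifs
  · rw [← decodeList_toNode A C C' P N ω u]
    rfl
  · rfl

open Classical in
lemma allAccept_iff (A : Scheme) (C : Codec F ℓ 6) (C' : Codec F b 4) (P : Prover n ℓ)
    (N : Network n ℕ) (ω : Randomness (verifier n A C C') P) :
    AllAccept (verifier n A C C') P N (2 * A.R) 1 ω ↔ ∀ v,
      NodeAccepts A (N.input v) (coinAt (ω.2 v)) (messagesOf A C P ω.1 (coinAt (ω.2 0)) v)
        fun u => if N.graph.Adj u v then
          some (nodeMsg A (N.input u) (messagesOf A C P ω.1 (coinAt (ω.2 0)) u) v) else none := by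
  unfold AllAccept LocalAlg.run
  refine forall_congr' fun v => ?_
  rw [received_verifier]
  have e : (fun u => Option.map C'.dec (if N.graph.Adj u v then
        some (C'.enc (nodeMsg A (N.input u) (messagesOf A C P ω.1 (coinAt (ω.2 0)) u) v))
        else none)) = fun u => if N.graph.Adj u v then
          some (nodeMsg A (N.input u) (messagesOf A C P ω.1 (coinAt (ω.2 0)) u) v) else none := by
    funext u
    split_ifs <;> simp [C'.dec_enc]
  rw [← decodeList_toNode A C C' P N ω v, ← e]
  exact decide_eq_true_iff

end Verifier

/-! ### Soundness -/

section Soundness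

variable {F : Type} [Field F] {n ℓ b : ℕ}

/-- A function which is constant along edges of a connected graph is constant. -/
lemma eq_of_connected {V α : Type*} {G : SimpleGraph V} (hG : G.Connected) {f : V → α}
    (h : ∀ u v, G.Adj u v → f u = f v) (u v : V) : f u = f v := by
  obtain ⟨p⟩ := hG.preconnected u v
  induction p with
  | nil => rfl
  | cons hadj _ ih => exact (h _ _ hadj).trans ih

/-- The equations use nothing from the last round, so they are fixed before the batching coin is
drawn. -/
lemma eqn_congr (A : Scheme) (hκ : 0 < A.κ) {c c' : ℕ → F} (claim : F) (u : Fin n)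
    (nbr : Fin n → Bool) {D D' : Messages F} (hc : ∀ t < A.R - 1, c t = c' t)
    (hD : ∀ t < A.R - 1, D t = D' t) {j : ℕ} (hj : j < A.R) :
    eqn A c claim u nbr D j = eqn A c' claim u nbr D' j := by
  have hR : A.R = A.T + A.κ + 2 := rfl
  have hp : ∀ t ≤ A.T, ∀ z, piece u D t z = piece u D' t z := fun t ht z => by
    unfold piece
    rw [hD t (by omega)]
  have hm : ∀ i < A.κ, maskedFactor A D i = maskedFactor A D' i := fun i hi => by
    unfold maskedFactor
    rw [hD _ (by omega)]
  unfold eqn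
  split_ifs with h0 h1 h2 h3 h4 h5
  · rw [funext (hp 0 (by omega))]
  · rw [funext (hp 0 (by omega))]
  · rw [funext (hp j (by omega)), hp (j - 1) (by omega), hc j (by omega)]
  · rw [hp _ le_rfl, hc _ (by omega)]
    congr 1
    exact Finset.prod_congr rfl fun i hi => hm i (mem_range.1 hi)
  · rw [hp _ le_rfl, hc _ (by omega)]
  · rw [hm _ (by omega), hD _ (by omega), hc (A.T + 1) (by omega),
      beta_congr A (by omega) u nbr fun t ht => hc (t + 1) (by omega)]
  · rw [hD _ (by omega), hc (A.T + 1) (by omega),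
      beta_congr A (by omega) u nbr fun t ht => hc (t + 1) (by omega)]

/-- Node `u` has received wrong public coins, but their fingerprint is right. -/
def BadFingerprint (A : Scheme) (c : ℕ → F) (D : Fin n → Messages F) (u : Fin n) : Prop :=
  (∃ t < A.R - 1, D u t 0 ≠ c t) ∧
    ∑ t ∈ range (A.R - 1), D u t 0 * c (A.R - 1) ^ t =
      ∑ t ∈ range (A.R - 1), c t * c (A.R - 1) ^ t

/-- Some equation is violated, but the weighted sum of all of them is zero. -/
def BadBatch (A : Scheme) (G : SimpleGraph (Fin n)) (c : ℕ → F) (claim : F)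
    (D : Fin n → Messages F) : Prop :=
  (∃ j < A.R, ∑ u, eqn A c claim u (adjRow G u) (D u) j ≠ 0) ∧
    ∑ u, D u 0 5 + ∑ j ∈ range A.R, c (A.R - 1) ^ (j + 1) *
      ∑ u, eqn A c claim u (adjRow G u) (D u) j = 0

open Classical in
-- A node learns its adjacency row from the fact that exactly its neighbours send it something.
lemma isSome_inbox_eq_adjRow {α : Type*} (G : SimpleGraph (Fin n)) (v : Fin n) (f : Fin n → α) :
    (fun u => (if G.Adj u v then some (f u) else none).isSome) = adjRow G v := by
  funext u
  unfold adjRow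
  by_cases h : G.Adj u v
  · simp [h, h.symm]
  · have h' : ¬ G.Adj v u := fun h' => h h'.symm
    simp [h, h']

variable [NeZero n]

/-- Every node but the root is counted once, at its parent. The root is its own parent but not its
own neighbour, so it is not counted. -/
lemma sum_children (N : Network n ℕ) [DecidableRel N.graph.Adj] (S : Fin n → F) :
    ∑ v, ∑ u, (if N.graph.Adj u v then (if v = N.parent u then S u else 0) else 0) =
      ∑ u, S u - S 0 := by
  rw [Finset.sum_comm, ← sum_ite_root S, ← Finset.sum_sub_distrib]
  refine Finset.sum_congr rfl fun u _ => ?_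
  rw [Finset.sum_eq_single (N.parent u)]
  · rw [if_pos rfl]
    by_cases h : (u : ℕ) = 0
    · simp [h, N.parent_root u h]
    · simp [h, N.adj_parent u h]
  · intro v _ hv
    rw [if_neg hv, ite_self]
  · simp

open Classical in
/-- If all nodes accept and no bad event happens, then the labels are correct. -/
lemma labels_of_accepts (A : Scheme) (hκ : 0 < A.κ) (hn : n ≤ 2 ^ A.m) (hT : 0 < A.T)
    (haut : 0 < A.aut)
    (hcast : ∀ a b : ℕ, a ≤ A.bound → b ≤ A.bound → (a : F) = b → a = b)
    (N : Network n ℕ) (hbound : tupleCount A.pat (A.κ + 1) N.graph ≤ A.bound)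
    (coin : Fin n → ℕ → F) (D : Fin n → Messages F)
    (hacc : ∀ v, NodeAccepts A (N.input v) (coin v) (D v)
      fun u => if N.graph.Adj u v then some (nodeMsg A (N.input u) (D u) v) else none)
    (hround : ∀ t ≤ A.T, ¬ BadRound A N.graph (coin 0) D t)
    (hfinger : ∀ u, ¬ BadFingerprint A (coin 0) D u)
    (hbatch : ¬ BadBatch A N.graph (coin 0) ((N.label 0 * A.aut : ℕ) : F) D) :
    (∀ v, N.label v = N.label 0) ∧
      N.label 0 * A.aut = tupleCount A.pat (A.κ + 1) N.graph := by
  -- Neighbours compare `label * aut` in the field; the bound checked by every node makes the cast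
  -- injective.
  have hlab : ∀ v, N.label v = N.label 0 := by
    refine fun v => eq_of_connected N.connected (fun u v huv => ?_) v 0
    have h1 := (hacc v).nbr_label u _ (if_pos huv)
    have h2 := hcast _ _ (hacc u).label_le (hacc v).label_le (by simpa [nodeMsg] using h1)
    exact Nat.eq_of_mul_eq_mul_right haut h2
  have hroot : ∀ t < A.R, D 0 t 0 = coin 0 t := (hacc 0).root_coin (by simp [Network.input])
  have hR : A.R = A.T + A.κ + 2 := rfl
  have hlast : ∀ u, D u (A.R - 1) 0 = coin 0 (A.R - 1) := by
    intro u
    rw [← hroot _ (by omega)]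
    refine eq_of_connected (f := fun u => D u (A.R - 1) 0) N.connected (fun u v huv => ?_) u 0
    have h1 := (hacc v).nbr_coin u _ (if_pos huv)
    simpa [nodeMsg] using h1
  have hfp : ∀ u, fingerprint A (D u) = fingerprint A (D 0) := by
    intro u
    refine eq_of_connected (f := fun u => fingerprint A (D u)) N.connected (fun u v huv => ?_) u 0
    have h1 := (hacc v).nbr_fingerprint u _ (if_pos huv)
    simpa [nodeMsg] using h1
  -- The earlier coins are never compared directly: with a common last coin, equal fingerprints
  -- force equal coins unless the fingerprint is bad.
  have hcoin : ∀ u, ∀ t < A.R, D u t 0 = coin 0 t := by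
    intro u t ht
    rcases Nat.lt_or_ge t (A.R - 1) with h | h
    · by_contra hne
      refine hfinger u ⟨⟨t, h, hne⟩, ?_⟩
      have := hfp u
      unfold fingerprint at this
      rw [hlast u, hlast 0] at this
      rw [this]
      refine Finset.sum_congr rfl fun i hi => ?_
      rw [hroot i (by have := mem_range.1 hi; omega)]
    · obtain rfl : t = A.R - 1 := by omega
      exact hlast u
  have hloc : ∀ v, localSum A (fun t => D v t 0) ((N.label v * A.aut : ℕ) : F) v
      (fun u => (if N.graph.Adj u v then some (nodeMsg A (N.input u) (D u) v) else none).isSome)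
      (D v) = ∑ j ∈ range A.R, coin 0 (A.R - 1) ^ (j + 1) *
        eqn A (coin 0) ((N.label 0 * A.aut : ℕ) : F) v (adjRow N.graph v) (D v) j := by
    intro v
    unfold localSum
    refine Finset.sum_congr rfl fun j hj => ?_
    rw [isSome_inbox_eq_adjRow, hlab v, show (fun t => D v t 0) (A.R - 1) = _ from hlast v]
    congr 1
    exact eqn_congr A hκ _ v _ (fun t ht => hcoin v t (by omega)) (fun _ _ => rfl)
      (mem_range.1 hj)
  have hsum : ∑ v, D v 0 5 + ∑ j ∈ range A.R, coin 0 (A.R - 1) ^ (j + 1) *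
      ∑ u, eqn A (coin 0) ((N.label 0 * A.aut : ℕ) : F) u (adjRow N.graph u) (D u) j = 0 := by
    -- Adding the tests of all nodes, each subtree sum cancels against its occurrence at the parent,
    -- except for the sum at the root, which is checked to be zero.
    have h1 : ∑ v, D v (A.R - 1) 5 = ∑ v, D v 0 5 + ∑ v, (∑ j ∈ range A.R,
        coin 0 (A.R - 1) ^ (j + 1) *
          eqn A (coin 0) ((N.label 0 * A.aut : ℕ) : F) v (adjRow N.graph v) (D v) j) +
        ∑ v, ∑ u, (if N.graph.Adj u v then (if v = N.parent u then D u (A.R - 1) 5 else 0)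
          else 0) := by
      rw [← Finset.sum_add_distrib, ← Finset.sum_add_distrib]
      refine Finset.sum_congr rfl fun v _ => ?_
      have := (hacc v).sum_eq
      simp only [Network.input] at this hloc
      rw [hloc v] at this
      rw [this]
      congr 1
      refine Finset.sum_congr rfl fun u _ => ?_
      by_cases h : N.graph.Adj u v <;> simp [nodeMsg, h]
    rw [sum_children N fun u => D u (A.R - 1) 5,
      (hacc 0).root_sum (by simp [Network.input]), sub_zero, right_eq_add] at h1
    rw [← h1, Finset.sum_comm (s := univ)]
    simp only [Finset.mul_sum]
  have heq : ∀ j < A.R, ∑ u, eqn A (coin 0) ((N.label 0 * A.aut : ℕ) : F) u (adjRow N.graph u)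
      (D u) j = 0 := by
    by_contra hcon
    push Not at hcon
    exact hbatch ⟨hcon, hsum⟩
  refine ⟨hlab, hcast _ _ (hacc 0).label_le hbound ?_⟩
  exact claim_eq_of_eqns A hκ hn hT N.graph (coin 0)
    (fun _ => ((N.label 0 * A.aut : ℕ) : F)) D heq hround

end Soundness

/-! ### Counting the coins that help a dishonest prover -/

section SoundnessBound

variable {F : Type} [Field F] {n ℓ b : ℕ}

/-- The coins in which the coin with number `τ` is shifted by `x`. -/
def shiftCoin (c : ℕ → F) (τ : ℕ) (x : F) : ℕ → F := fun i => c i + if i = τ then x else 0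

lemma shiftCoin_of_lt (c : ℕ → F) {τ i : ℕ} (x : F) (h : i < τ) : shiftCoin c τ x i = c i := by
  simp [shiftCoin, h.ne]

lemma shiftCoin_self (c : ℕ → F) (τ : ℕ) (x : F) : shiftCoin c τ x τ = c τ + x := by
  simp [shiftCoin]

/-- Only the coins of the root are public, so moving along this direction changes exactly one public
coin. -/
lemma coinAt_shift {R : ℕ} [NeZero n] (κ : Fin n → Fin R → F) (τ : Fin R) (x : F) :
    coinAt ((κ + x • (Pi.single 0 (Pi.single τ 1) : Fin n → Fin R → F)) 0) =
      shiftCoin (coinAt (κ 0)) τ x := by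
  funext i
  unfold coinAt shiftCoin
  by_cases hi : i < R
  · simp only [hi, dite_true]
    by_cases h : i = τ
    · subst h
      simp
    · have h' : (⟨i, hi⟩ : Fin R) ≠ τ := fun hc => h (congrArg Fin.val hc)
      simp [h, Pi.single_eq_of_ne h']
  · have h : i ≠ τ := fun h => hi (h ▸ τ.2)
    simp [hi, h]

variable [Fintype F]

open Classical in
/-- If on every line in direction `e` at most `d` points belong to `B`, then the density of `B` is
at most `d / |F|`. -/
lemma card_mul_le_of_lines {S M : Type*} [Fintype S] [Fintype M] [AddCommGroup M] [Module F M]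
    (e : M) (B : S × M → Prop) (d : ℕ)
    (h : ∀ ω : S × M, (univ.filter fun x : F => B (ω.1, ω.2 + x • e)).card ≤ d) :
    (univ.filter B).card * Fintype.card F ≤ d * Fintype.card (S × M) := by
  have h1 : ∀ x : F, (univ.filter fun ω : S × M => B (ω.1, ω.2 + x • e)).card =
      (univ.filter B).card := by
    intro x
    refine Finset.card_bij (fun ω _ => (ω.1, ω.2 + x • e)) ?_ ?_ ?_
    · intro ω hω
      simpa using hω
    · rintro ⟨a, m⟩ _ ⟨a', m'⟩ _ heq
      simpa using heq
    · rintro ⟨a, m⟩ hm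
      refine ⟨(a, m - x • e), ?_, by simp⟩
      simpa using hm
  calc (univ.filter B).card * Fintype.card F
      = ∑ x : F, (univ.filter fun ω : S × M => B (ω.1, ω.2 + x • e)).card := by
        simp only [h1, Finset.sum_const, Finset.card_univ, smul_eq_mul, mul_comm]
    _ = ∑ ω : S × M, (univ.filter fun x : F => B (ω.1, ω.2 + x • e)).card := by
        simp only [Finset.card_filter]
        exact Finset.sum_comm
    _ ≤ ∑ _ω : S × M, d := Finset.sum_le_sum fun ω _ => h ω
    _ = d * Fintype.card (S × M) := by
        simp only [Finset.sum_const, Finset.card_univ, smul_eq_mul, mul_comm]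

open Classical in
-- Translation preserves cardinality. The extra point is `x = -a`, where `ev` may differ from the
-- identity, as `nz` does at `0`.
lemma card_filter_shift_le (Q : F → Prop) (a : F) (ev : F → F) (hev : ∀ z, z ≠ 0 → ev z = z) :
    (univ.filter fun x => Q (ev (a + x))).card ≤ (univ.filter Q).card + 1 := by
  refine (Finset.card_le_card_of_injOn (t := insert 0 (univ.filter Q)) (fun x => a + x) ?_
    (fun x _ y _ h => add_left_cancel h)).trans (Finset.card_insert_le _ _)
  intro x hx
  simp only [coe_filter, mem_univ, true_and, Set.mem_ofPred_eq] at hx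
  by_cases h0 : a + x = 0
  · simp [h0]
  · rw [hev _ h0] at hx
    simp [hx]

open Classical in
-- Both polynomials of round `t` are fixed before coin `t + 1` is drawn. In round `T` this includes
-- the masks, which are sent in the messages with numbers below `κ ≤ T`. Different polynomials agree
-- on at most `n - 1` points, and `nz` costs one more.
lemma card_badRound_le (A : Scheme) (hn : A.κ < n) (hκT : A.κ ≤ A.T) (C : Codec F ℓ 6)
    (P : Prover n ℓ) (seed : P.Seed) (G : SimpleGraph (Fin n)) (c : ℕ → F) {t : ℕ} (ht : t ≤ A.T) :
    (univ.filter fun x : F => BadRound A G (shiftCoin c (t + 1) x)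
      (messagesOf A C P seed (shiftCoin c (t + 1) x)) t).card ≤ n := by
  set D := messagesOf A C P seed c with hD
  have hmsg : ∀ x, ∀ i ≤ t, ∀ v, messagesOf A C P seed (shiftCoin c (t + 1) x) v i = D v i :=
    fun x i hi v => messagesOf_congr A C P seed
      (fun j hj => shiftCoin_of_lt c x (by omega)) v
  have hshared : ∀ x z, sharedFun (messagesOf A C P seed (shiftCoin c (t + 1) x)) t z =
      sharedFun D t z := by
    intro x z
    unfold sharedFun piece
    exact Finset.sum_congr rfl fun u _ => by rw [hmsg x t le_rfl]
  have hround : ∀ x z, roundFun A G (sharedMask (messagesOf A C P seed (shiftCoin c (t + 1) x))) t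
      (fun i => shiftCoin c (t + 1) x (i + 1)) z =
        roundFun A G (sharedMask D) t (fun i => c (i + 1)) z := by
    intro x z
    refine roundFun_congr A G (fun i hi => shiftCoin_of_lt c x (by omega)) ?_ z
    intro hT i hi
    unfold sharedMask
    exact Finset.sum_congr rfl fun u _ => by rw [hmsg x i (by omega)]
  obtain ⟨p, hp⟩ := sharedFun_coeffs D t
  obtain ⟨p', hp'⟩ := roundFun_coeffs A hn G (sharedMask D) t (fun i => c (i + 1))
  by_cases hne : ∃ z, sharedFun D t z ≠ roundFun A G (sharedMask D) t (fun i => c (i + 1)) z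
  · obtain ⟨z₀, hz₀⟩ := hne
    rw [hp, hp'] at hz₀
    have hlt := card_agree_lt (c := p) (c' := p') fun h => hz₀ (by rw [h])
    set ev : F → F := fun z => if t < A.T then z else nz z with hev
    have hevp : ∀ x, evalPoint A (shiftCoin c (t + 1) x) t = ev (c (t + 1) + x) := by
      intro x
      simp only [evalPoint, hev]
      split_ifs with h
      · rw [shiftCoin_self]
      · obtain rfl : t = A.T := by omega
        rw [shiftCoin_self]
    refine (Finset.card_le_card (t := univ.filter fun x => (fun z => ∑ j, p j * z ^ (j : ℕ) =
      ∑ j, p' j * z ^ (j : ℕ)) (ev (c (t + 1) + x))) ?_).trans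
        ((card_filter_shift_le _ _ ev ?_).trans hlt)
    · intro x hx
      simp only [mem_filter, mem_univ, true_and] at hx ⊢
      have := hx.2
      rwa [hshared, hround, hevp, hp, hp'] at this
    · intro z hz
      simp only [hev, nz, hz, if_false, ite_self]
  · rw [Finset.filter_false_of_mem]
    · simp
    · rintro x - ⟨⟨z, hz⟩, -⟩
      rw [hshared, hround] at hz
      exact hne ⟨z, hz⟩

open Classical in
-- The coins that the prover reports in earlier rounds are fixed before the last coin, at which two
-- different polynomials of degree less than `R - 1` would have to agree.
lemma card_badFingerprint_le (A : Scheme) (C : Codec F ℓ 6)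
    (P : Prover n ℓ) (seed : P.Seed) (c : ℕ → F) (u : Fin n) :
    (univ.filter fun x : F => BadFingerprint A (shiftCoin c (A.R - 1) x)
      (messagesOf A C P seed (shiftCoin c (A.R - 1) x)) u).card ≤ A.R := by
  set D := messagesOf A C P seed c with hD
  have hmsg : ∀ x, ∀ i < A.R - 1,
      messagesOf A C P seed (shiftCoin c (A.R - 1) x) u i = D u i :=
    fun x i hi => messagesOf_congr A C P seed
      (fun j hj => shiftCoin_of_lt c x (by omega)) u
  by_cases hne : ∃ t < A.R - 1, D u t 0 ≠ c t
  · set p : Fin (A.R - 1) → F := fun j => D u j 0 with hp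
    set p' : Fin (A.R - 1) → F := fun j => c j with hp'
    have hpp : p ≠ p' := by
      obtain ⟨t, ht, h⟩ := hne
      exact fun heq => h (congrFun heq ⟨t, ht⟩)
    have hlt := card_agree_lt hpp
    have hshift := card_filter_shift_le
      (fun z => ∑ j, p j * z ^ (j : ℕ) = ∑ j, p' j * z ^ (j : ℕ)) (c (A.R - 1)) (fun z => z)
      fun _ _ => rfl
    refine (Finset.card_le_card ?_).trans
      (hshift.trans ((Nat.succ_le_of_lt hlt).trans (Nat.sub_le _ _)))
    intro x hx
    simp only [mem_filter, mem_univ, true_and] at hx ⊢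
    have h2 := hx.2
    rw [shiftCoin_self, ← Fin.sum_univ_eq_sum_range
      (fun t => messagesOf A C P seed (shiftCoin c (A.R - 1) x) u t 0 * (c (A.R - 1) + x) ^ t),
      ← Fin.sum_univ_eq_sum_range
      (fun t => shiftCoin c (A.R - 1) x t * (c (A.R - 1) + x) ^ t)] at h2
    refine Eq.trans (Finset.sum_congr rfl fun i _ => ?_)
      (h2.trans (Finset.sum_congr rfl fun i _ => ?_))
    · rw [hmsg x i i.2]
    · rw [shiftCoin_of_lt c x i.2]
  · rw [Finset.filter_false_of_mem]
    · simp
    · rintro x - ⟨⟨t, ht, hz⟩, -⟩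
      rw [hmsg x t ht, shiftCoin_of_lt c x ht] at hz
      exact hne ⟨t, ht, hz⟩

open Classical in
-- The batched sum is a polynomial of degree at most `R` in the last coin. Its constant term is the
-- sum of the tree masks, which a prover may choose at will in its first message. As the equations
-- are weighted by exponents from `1` on, this term cannot cancel a violated one.
lemma card_badBatch_le (A : Scheme) (hκ : 0 < A.κ) (C : Codec F ℓ 6)
    (P : Prover n ℓ) (seed : P.Seed) (G : SimpleGraph (Fin n)) (claim : F) (c : ℕ → F) :
    (univ.filter fun x : F => BadBatch A G (shiftCoin c (A.R - 1) x) claim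
      (messagesOf A C P seed (shiftCoin c (A.R - 1) x))).card ≤ A.R + 1 := by
  set D := messagesOf A C P seed c with hD
  have hR : A.R = A.T + A.κ + 2 := rfl
  have hmsg : ∀ x u, ∀ i < A.R - 1,
      messagesOf A C P seed (shiftCoin c (A.R - 1) x) u i = D u i :=
    fun x u i hi => messagesOf_congr A C P seed
      (fun j hj => shiftCoin_of_lt c x (by omega)) u
  set E : ℕ → F := fun j => ∑ u, eqn A c claim u (adjRow G u) (D u) j with hE
  have hEx : ∀ x, ∀ j < A.R, ∑ u, eqn A (shiftCoin c (A.R - 1) x) claim u (adjRow G u)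
      (messagesOf A C P seed (shiftCoin c (A.R - 1) x) u) j = E j := fun x j hj =>
    Finset.sum_congr rfl fun u _ => eqn_congr A hκ claim u _
      (fun t ht => shiftCoin_of_lt c x ht) (fun t ht => hmsg x u t ht) hj
  by_cases hne : ∃ j < A.R, E j ≠ 0
  · set p : Fin (A.R + 1) → F := Fin.cons (∑ u, D u 0 5) fun j : Fin A.R => E j with hp
    have hpp : p ≠ fun _ => 0 := by
      obtain ⟨t, ht, h⟩ := hne
      intro heq
      have := congrFun heq (Fin.succ ⟨t, ht⟩)
      rw [hp, Fin.cons_succ] at this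
      exact h this
    have hlt := card_agree_lt hpp
    have hshift := card_filter_shift_le
      (fun z => ∑ j, p j * z ^ (j : ℕ) = ∑ j : Fin (A.R + 1), 0 * z ^ (j : ℕ)) (c (A.R - 1))
      (fun z => z) fun _ _ => rfl
    refine (Finset.card_le_card ?_).trans (hshift.trans hlt)
    intro x hx
    simp only [mem_filter, mem_univ, true_and] at hx ⊢
    have h2 := hx.2
    rw [shiftCoin_self] at h2
    rw [Fin.sum_univ_succ]
    simp only [hp, Fin.cons_zero, Fin.cons_succ, Fin.val_zero, pow_zero, mul_one, Fin.val_succ,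
      zero_mul, Finset.sum_const_zero]
    rw [← h2, ← Fin.sum_univ_eq_sum_range (fun j => (c (A.R - 1) + x) ^ (j + 1) *
      ∑ u, eqn A (shiftCoin c (A.R - 1) x) claim u (adjRow G u)
      (messagesOf A C P seed (shiftCoin c (A.R - 1) x) u) j)]
    congr 1
    · exact Finset.sum_congr rfl fun u _ => by rw [hmsg x u 0 (by omega)]
    · exact Finset.sum_congr rfl fun j _ => by rw [hEx x j j.2, mul_comm]
  · rw [Finset.filter_false_of_mem]
    · simp
    · rintro x - ⟨⟨j, hj, hz⟩, -⟩
      rw [hEx x j hj] at hz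
      exact hne ⟨j, hj, hz⟩

variable [NeZero n]

open Classical in
/-- No prover convinces all nodes of a wrong label with probability more than `1/3`. -/
lemma acceptProb_le (A : Scheme) (hκ : 0 < A.κ) (hκn : A.κ < n) (hn : n ≤ 2 ^ A.m) (hT : 0 < A.T)
    (hκT : A.κ ≤ A.T) (haut : 0 < A.aut)
    (hcast : ∀ a b : ℕ, a ≤ A.bound → b ≤ A.bound → (a : F) = b → a = b)
    (hq : 3 * ((A.T + 1) * n + n * A.R + (A.R + 1)) ≤ Fintype.card F)
    (C : Codec F ℓ 6) (C' : Codec F b 4) (P : Prover n ℓ)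
    (N : Network n ℕ) (hbound : tupleCount A.pat (A.κ + 1) N.graph ≤ A.bound)
    (hN : ¬ ∃ Δ : ℕ, (∀ v, N.label v = Δ) ∧ Δ * A.aut = tupleCount A.pat (A.κ + 1) N.graph) :
    acceptProb (verifier n A C C') P N (2 * A.R) 1 ≤ 1 / 3 := by
  set Ω := Randomness (verifier n A C C') P
  have hR : A.R = A.T + A.κ + 2 := rfl
  let c : Ω → ℕ → F := fun ω => coinAt (ω.2 0)
  let D : Ω → Fin n → Messages F := fun ω => messagesOf A C P ω.1 (c ω)
  let acc : Finset Ω := univ.filter fun ω => AllAccept (verifier n A C C') P N (2 * A.R) 1 ω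
  let B₁ : ℕ → Finset Ω := fun t => univ.filter fun ω => BadRound A N.graph (c ω) (D ω) t
  let B₂ : Fin n → Finset Ω := fun u => univ.filter fun ω => BadFingerprint A (c ω) (D ω) u
  let B₃ : Finset Ω := univ.filter fun ω =>
    BadBatch A N.graph (c ω) ((N.label 0 * A.aut : ℕ) : F) (D ω)
  have hsub : acc ⊆ ((range (A.T + 1)).biUnion B₁ ∪ univ.biUnion B₂) ∪ B₃ := by
    intro ω hω
    by_contra hcon
    simp only [mem_union, mem_biUnion, mem_range, mem_univ, true_and, not_or, not_exists,
      not_and, B₁, B₂, B₃, mem_filter] at hcon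
    obtain ⟨⟨h1, h2⟩, h3⟩ := hcon
    have hacc := (allAccept_iff A C C' P N ω).1 (mem_filter.1 hω).2
    exact hN ⟨_, labels_of_accepts A hκ hn hT haut hcast N hbound (fun v => coinAt (ω.2 v)) (D ω)
      hacc (fun t ht => h1 t (by omega)) h2 h3⟩
  have hB₁ : ∀ t ∈ range (A.T + 1), (B₁ t).card * Fintype.card F ≤ n * Fintype.card Ω := by
    intro t ht
    have ht' := mem_range.1 ht
    -- All randomness except the root's coin `t + 1` is held fixed.
    refine card_mul_le_of_lines (S := P.Seed) (M := Fin n → Fin A.R → F)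
      (Pi.single 0 (Pi.single ⟨t + 1, by omega⟩ 1)) _ n fun ω => ?_
    simp only [c, D, coinAt_shift]
    exact card_badRound_le A hκn hκT C P ω.1 N.graph _ (by omega)
  have hB₂ : ∀ u ∈ (univ : Finset (Fin n)),
      (B₂ u).card * Fintype.card F ≤ A.R * Fintype.card Ω := by
    intro u _
    refine card_mul_le_of_lines (S := P.Seed) (M := Fin n → Fin A.R → F)
      (Pi.single 0 (Pi.single ⟨A.R - 1, by omega⟩ 1)) _ A.R fun ω => ?_
    simp only [c, D, coinAt_shift]
    exact card_badFingerprint_le A C P ω.1 _ u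
  have hB₃ : B₃.card * Fintype.card F ≤ (A.R + 1) * Fintype.card Ω := by
    refine card_mul_le_of_lines (S := P.Seed) (M := Fin n → Fin A.R → F)
      (Pi.single 0 (Pi.single ⟨A.R - 1, by omega⟩ 1)) _ (A.R + 1) fun ω => ?_
    simp only [c, D, coinAt_shift]
    exact card_badBatch_le A hκ C P ω.1 N.graph _ _
  have htotal : acc.card * Fintype.card F ≤
      ((A.T + 1) * n + n * A.R + (A.R + 1)) * Fintype.card Ω := by
    calc acc.card * Fintype.card F
        ≤ (∑ t ∈ range (A.T + 1), (B₁ t).card + ∑ u, (B₂ u).card + B₃.card) *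
            Fintype.card F := by
          refine Nat.mul_le_mul_right _ ((Finset.card_le_card hsub).trans ?_)
          refine (Finset.card_union_le _ _).trans (Nat.add_le_add_right ?_ _)
          exact (Finset.card_union_le _ _).trans
            (Nat.add_le_add Finset.card_biUnion_le Finset.card_biUnion_le)
      _ ≤ ∑ t ∈ range (A.T + 1), n * Fintype.card Ω + ∑ u : Fin n, A.R * Fintype.card Ω +
            (A.R + 1) * Fintype.card Ω := by
          rw [add_mul, add_mul, Finset.sum_mul, Finset.sum_mul]
          exact Nat.add_le_add (Nat.add_le_add (Finset.sum_le_sum hB₁) (Finset.sum_le_sum hB₂)) hB₃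
      _ = _ := by
          simp only [Finset.sum_const, card_range, Finset.card_univ, Fintype.card_fin, smul_eq_mul]
          ring
  have h3 : 3 * acc.card ≤ Fintype.card Ω := by
    have hF : 0 < Fintype.card F := Fintype.card_pos
    refine Nat.le_of_mul_le_mul_right ?_ hF
    calc 3 * acc.card * Fintype.card F = 3 * (acc.card * Fintype.card F) := by ring
      _ ≤ 3 * (((A.T + 1) * n + n * A.R + (A.R + 1)) * Fintype.card Ω) :=
          Nat.mul_le_mul_left _ htotal
      _ = 3 * ((A.T + 1) * n + n * A.R + (A.R + 1)) * Fintype.card Ω := by ring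
      _ ≤ Fintype.card F * Fintype.card Ω := Nat.mul_le_mul_right _ hq
      _ = Fintype.card Ω * Fintype.card F := mul_comm _ _
  have hΩ : (Fintype.card Ω : ENNReal) ≠ 0 := by
    exact_mod_cast Fintype.card_ne_zero
  have hcard : acceptProb (verifier n A C C') P N (2 * A.R) 1 =
      (acc.card : ENNReal) / Fintype.card Ω := by
    unfold acceptProb
    rw [PMF.toOuterMeasure_uniformOfFintype_apply]
    congr 2
    exact Fintype.card_subtype _
  rw [hcard]
  refine ENNReal.div_le_of_le_mul ?_
  rw [one_div, mul_comm, ← div_eq_mul_inv,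
    ENNReal.le_div_iff_mul_le (.inl (by norm_num)) (.inl (by norm_num))]
  exact_mod_cast (by rw [mul_comm]; exact h3)

end SoundnessBound

/-! ### The honest prover -/

section Honest

variable {F : Type} [Field F] {n ℓ b : ℕ}

open Classical in
/-- The indicator of the children of `v`. -/
def childFlag (N : Network n ℕ) (v u : Fin n) : F :=
  if N.graph.Adj u v then (if v = N.parent u then 1 else 0) else 0

/-- The sum of `S` over the children of `v`. -/
def childSum (N : Network n ℕ) (S : Fin n → F) (v : Fin n) : F := ∑ u, childFlag N v u * S u

lemma childSum_add (N : Network n ℕ) (S S' : Fin n → F) (v : Fin n) :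
    childSum N (fun u => S u + S' u) v = childSum N S v + childSum N S' v := by
  simp only [childSum, mul_add, Finset.sum_add_distrib]

/-- Every function on the nodes has a function of sums over subtrees. -/
lemma exists_subtreeSum (N : Network n ℕ) (f : Fin n → F) :
    ∃ S : Fin n → F, ∀ v, S v = f v + childSum N S v := by
  classical
  let B : Matrix (Fin n) (Fin n) F := Matrix.of fun v u => childFlag N v u
  -- A vector in the kernel of the transpose takes the same value at a node and at its parent and
  -- vanishes at the root. Since every node reaches the root, it is zero; so `1 - B` is invertible.
  have hinj : Injective (1 - B).transpose.mulVec := by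
    rw [← Matrix.coe_mulVecLin, ← LinearMap.ker_eq_bot, LinearMap.ker_eq_bot']
    intro g hg
    have hg' : ∀ u, g u = if (u : ℕ) = 0 then 0 else g (N.parent u) := by
      intro u
      have h1 := congrFun hg u
      rw [Matrix.mulVecLin_apply, Matrix.transpose_sub, Matrix.sub_mulVec, Matrix.transpose_one,
        Matrix.one_mulVec, Pi.sub_apply, Pi.zero_apply, sub_eq_zero] at h1
      rw [h1, Matrix.mulVec, dotProduct, Finset.sum_eq_single (N.parent u)]
      · by_cases h : (u : ℕ) = 0
        · simp [B, childFlag, h, N.parent_root u h]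
        · simp [B, childFlag, h, N.adj_parent u h]
      · intro v _ hv
        simp [B, childFlag, hv]
      · simp
    have key : ∀ m u, ((N.parent^[m]) u : ℕ) = 0 → g u = 0 := by
      intro m
      induction m with
      | zero =>
        intro u hu
        rw [hg' u, if_pos (by simpa using hu)]
      | succ m ih =>
        intro u hu
        rw [hg' u]
        split_ifs
        · rfl
        · exact ih _ (by simpa using hu)
    funext u
    obtain ⟨m, hm⟩ := N.reaches_root u
    exact key m u hm
  have hunit : IsUnit (1 - B) :=
    (Matrix.isUnit_transpose _).1 (Matrix.mulVec_injective_iff_isUnit.1 hinj)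
  obtain ⟨S, hS⟩ := Matrix.mulVec_surjective_iff_isUnit.2 hunit f
  refine ⟨S, fun v => ?_⟩
  have h1 := congrFun hS v
  rw [Matrix.sub_mulVec, Matrix.one_mulVec, Pi.sub_apply, sub_eq_iff_eq_add] at h1
  exact h1

/-- The sums of `f` over the subtrees. -/
def subtreeSum (N : Network n ℕ) (f : Fin n → F) : Fin n → F := (exists_subtreeSum N f).choose

lemma subtreeSum_eq (N : Network n ℕ) (f : Fin n → F) (v : Fin n) :
    subtreeSum N f v = f v + childSum N (subtreeSum N f) v :=
  (exists_subtreeSum N f).choose_spec v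

/-- Summing the recursion over all nodes, everything but the value at the root cancels by
`sum_children`. -/
lemma subtreeSum_root [NeZero n] (N : Network n ℕ) (f : Fin n → F) :
    subtreeSum N f 0 = ∑ v, f v := by
  classical
  have h1 : ∑ v, subtreeSum N f v = ∑ v, f v + ∑ v, childSum N (subtreeSum N f) v := by
    rw [← Finset.sum_add_distrib]
    exact Finset.sum_congr rfl fun v _ => subtreeSum_eq N f v
  have h2 : ∑ v, childSum N (subtreeSum N f) v = ∑ v, subtreeSum N f v - subtreeSum N f 0 := by
    rw [← sum_children N]
    refine Finset.sum_congr rfl fun v _ => Finset.sum_congr rfl fun u _ => ?_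
    unfold childFlag
    split_ifs <;> simp
  rw [h2] at h1
  linear_combination h1

open Classical in
/-- Coefficients of a polynomial function of degree less than `n`. -/
def polyCoeff (n : ℕ) (g : F → F) : Fin n → F :=
  if h : ∃ c : Fin n → F, ∀ z, g z = ∑ j, c j * z ^ (j : ℕ) then h.choose else 0

lemma polyCoeff_spec {g : F → F} (h : ∃ c : Fin n → F, ∀ z, g z = ∑ j, c j * z ^ (j : ℕ)) (z : F) :
    ∑ j, polyCoeff n g j * z ^ (j : ℕ) = g z := by
  rw [polyCoeff, dif_pos h]
  exact (h.choose_spec z).symm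

/-- The messages to a node with the given coins, shares, masked factors, mask and subtree sum. -/
def assemble (A : Scheme) (c a a' μ y : ℕ → F) (w S : F) : Messages F := fun t =>
  if t < A.R then
    ![c t, a t, a' t, μ t, if A.T < t ∧ t < A.T + 1 + A.κ then y (t - A.T - 1) else 0,
      if t = 0 then w else if t = A.R - 1 then S else 0]
  else 0

lemma assemble_coin (A : Scheme) (c a a' μ y : ℕ → F) (w S : F) {t : ℕ} (ht : t < A.R) :
    assemble A c a a' μ y w S t 0 = c t := by
  rw [assemble, if_pos ht]
  rfl

lemma assemble_share (A : Scheme) (c a a' μ y : ℕ → F) (w S : F) {t : ℕ} (ht : t < A.R) :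
    assemble A c a a' μ y w S t 1 = a t := by
  rw [assemble, if_pos ht]
  rfl

lemma assemble_share' (A : Scheme) (c a a' μ y : ℕ → F) (w S : F) {t : ℕ} (ht : t < A.R) :
    assemble A c a a' μ y w S t 2 = a' t := by
  rw [assemble, if_pos ht]
  rfl

lemma assemble_mask (A : Scheme) (c a a' μ y : ℕ → F) (w S : F) {t : ℕ} (ht : t < A.R) :
    assemble A c a a' μ y w S t 3 = μ t := by
  rw [assemble, if_pos ht]
  rfl

lemma assemble_first (A : Scheme) (c a a' μ y : ℕ → F) (w S : F) :
    assemble A c a a' μ y w S 0 5 = w := by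
  rw [assemble, if_pos (show 0 < A.R from Nat.succ_pos _), if_pos rfl]
  rfl

lemma assemble_last (A : Scheme) (c a a' μ y : ℕ → F) (w S : F) :
    assemble A c a a' μ y w S (A.R - 1) 5 = S := by
  have hR : A.R = A.T + A.κ + 2 := rfl
  rw [assemble, if_pos (by omega), if_neg (show A.R - 1 ≠ 0 by omega), if_pos rfl]
  rfl

lemma assemble_of_le (A : Scheme) (c a a' μ y : ℕ → F) (w S : F) {t : ℕ} (ht : A.R ≤ t) :
    assemble A c a a' μ y w S t = 0 := by
  rw [assemble, if_neg (by omega)]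

lemma maskedFactor_assemble (A : Scheme) (c a a' μ y : ℕ → F) (w S : F) {i : ℕ} (hi : i < A.κ) :
    maskedFactor A (assemble A c a a' μ y w S) i = y i := by
  have hR : A.R = A.T + A.κ + 2 := rfl
  have h1 : A.T + 1 + i < A.R := by omega
  have h2 : A.T < A.T + 1 + i ∧ A.T + 1 + i < A.T + 1 + A.κ := by omega
  have h3 : A.T + 1 + i - A.T - 1 = i := by omega
  rw [maskedFactor, assemble, if_pos h1, if_pos h2, h3]
  rfl

lemma fingerprint_assemble (A : Scheme) (c a a' μ y : ℕ → F) (w S : F) :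
    fingerprint A (assemble A c a a' μ y w S) =
      ∑ t ∈ range (A.R - 1), c t * c (A.R - 1) ^ t := by
  have hR : A.R = A.T + A.κ + 2 := rfl
  have hlt : A.R - 1 < A.R := by omega
  unfold fingerprint
  refine Finset.sum_congr rfl fun t ht => ?_
  have ht' : t < A.R := by have := mem_range.1 ht; omega
  rw [assemble_coin A _ _ _ _ _ _ _ ht', assemble_coin A _ _ _ _ _ _ _ hlt]

lemma localSum_congr (A : Scheme) (c : ℕ → F) (claim : F) (u : Fin n) (nbr : Fin n → Bool)
    {D D' : Messages F} (h₁ : ∀ t, D t 1 = D' t 1) (h₂ : ∀ t, D t 2 = D' t 2)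
    (h₃ : ∀ t, D t 3 = D' t 3) (h₄ : ∀ i < A.κ, maskedFactor A D i = maskedFactor A D' i) :
    localSum A c claim u nbr D = localSum A c claim u nbr D' := by
  have hR : A.R = A.T + A.κ + 2 := rfl
  have hp : piece u D = piece u D' := by
    funext t z
    rw [piece, piece, h₁, h₂]
  refine Finset.sum_congr rfl fun j hj => ?_
  have hj' := mem_range.1 hj
  congr 1
  unfold eqn
  rw [hp, Finset.prod_congr rfl fun i hi => h₄ i (mem_range.1 hi), h₃]
  split_ifs with h0 h1 h2 h3 h4 h5
  · rfl
  · rfl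
  · rfl
  · rfl
  · rfl
  · rw [h₄ _ (by omega)]
  · rfl

/-- The equations read neither the tree mask nor the subtree sum. Hence the subtree sums can be
computed with placeholders for both, without circularity. -/
lemma localSum_assemble (A : Scheme) (c a a' μ y : ℕ → F) (w S w' S' claim : F) (u : Fin n)
    (nbr : Fin n → Bool) :
    localSum A c claim u nbr (assemble A c a a' μ y w S) =
      localSum A c claim u nbr (assemble A c a a' μ y w' S') := by
  refine localSum_congr A c claim u nbr (fun t => ?_) (fun t => ?_) (fun t => ?_) fun i hi => ?_
  · by_cases ht : t < A.R
    · rw [assemble_share A _ _ _ _ _ _ _ ht, assemble_share A _ _ _ _ _ _ _ ht]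
    · rw [assemble_of_le A _ _ _ _ _ _ _ (not_lt.1 ht),
        assemble_of_le A _ _ _ _ _ _ _ (not_lt.1 ht)]
  · by_cases ht : t < A.R
    · rw [assemble_share' A _ _ _ _ _ _ _ ht, assemble_share' A _ _ _ _ _ _ _ ht]
    · rw [assemble_of_le A _ _ _ _ _ _ _ (not_lt.1 ht),
        assemble_of_le A _ _ _ _ _ _ _ (not_lt.1 ht)]
  · by_cases ht : t < A.R
    · rw [assemble_mask A _ _ _ _ _ _ _ ht, assemble_mask A _ _ _ _ _ _ _ ht]
    · rw [assemble_of_le A _ _ _ _ _ _ _ (not_lt.1 ht),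
        assemble_of_le A _ _ _ _ _ _ _ (not_lt.1 ht)]
  · rw [maskedFactor_assemble A _ _ _ _ _ _ _ hi, maskedFactor_assemble A _ _ _ _ _ _ _ hi]

/-- The randomness of the honest prover: the shares of the coefficients, the shares of the masks of
the factors, and the masks of the sums over subtrees. -/
abbrev HonestSeed (F : Type) (n R : ℕ) : Type :=
  (Fin R → Fin n → F) × (Fin R → Fin n → F) × (Fin n → F)

/-- The masks of the factors. -/
def honestMask {R : ℕ} (M : Fin R → Fin n → F) (i : ℕ) : F := ∑ u, coinAt (fun j => M j u) i

/-- The masked factors. -/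
def honestFactor (A : Scheme) (N : Network n ℕ) (M : Fin A.R → Fin n → F) (c : ℕ → F) (i : ℕ) : F :=
  factor A N.graph (i + 1) (fun t => c (t + 1)) + nz (c (A.T + 1)) * honestMask M i

/-- The coefficients of the polynomial of round `t`. -/
def honestCoeff (A : Scheme) (N : Network n ℕ) (M : Fin A.R → Fin n → F) (c : ℕ → F) (t : ℕ) :
    Fin n → F :=
  polyCoeff n (roundFun A N.graph (honestMask M) t fun i => c (i + 1))

/-- The messages of the honest prover to node `v`, up to the mask `w` and the sum `S`. -/
def honestBase (A : Scheme) (N : Network n ℕ) (s : Fin A.R → Fin n → F)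
    (M : Fin A.R → Fin n → F) (c : ℕ → F) (v : Fin n) (w S : F) : Messages F :=
  assemble A c (coinAt fun i : Fin A.R => honestCoeff A N M c i v - s i v)
    (coinAt fun i => s i (finRotate n v)) (coinAt fun i => M i v) (honestFactor A N M c) w S

/-- The sums of the equations over subtrees. -/
def honestSum (A : Scheme) (N : Network n ℕ) (s : Fin A.R → Fin n → F)
    (M : Fin A.R → Fin n → F) (c : ℕ → F) : Fin n → F :=
  subtreeSum N fun v => localSum A c ((N.label v * A.aut : ℕ) : F) v (adjRow N.graph v)
    (honestBase A N s M c v 0 0)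

/-- The masks of the sums over subtrees. -/
def treeMask (m : Fin n → F) (v : Fin n) : F := if (v : ℕ) = 0 then 0 else m v

/-- The messages of the honest prover. -/
def honestMsgs (A : Scheme) (N : Network n ℕ) (σ : HonestSeed F n A.R) (c : ℕ → F) (v : Fin n) :
    Messages F :=
  honestBase A N σ.1 σ.2.1 c v (treeMask σ.2.2 v - childSum N (treeMask σ.2.2) v)
    (treeMask σ.2.2 v + honestSum A N σ.1 σ.2.1 c v)

/-- The honest messages can be computed online: masked factors appear only in messages after number
`T`, when coin `T + 1` is known. The last message is excluded because its subtree sum uses all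
coins. -/
lemma honestMsgs_congr (A : Scheme) (N : Network n ℕ) (σ : HonestSeed F n A.R) {c c' : ℕ → F}
    (v : Fin n) {t : ℕ} (ht : t < A.R - 1) (h : ∀ i ≤ t, c i = c' i) :
    honestMsgs A N σ c v t = honestMsgs A N σ c' v t := by
  have hR : A.R = A.T + A.κ + 2 := rfl
  have ht' : t < A.R := by omega
  have h1 : honestCoeff A N σ.2.1 c t = honestCoeff A N σ.2.1 c' t := by
    unfold honestCoeff
    congr 1
    funext z
    exact roundFun_congr A N.graph (fun i hi => h _ (by omega)) (fun _ _ _ => rfl) z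
  have h2 : A.T < t → honestFactor A N σ.2.1 c (t - A.T - 1) =
      honestFactor A N σ.2.1 c' (t - A.T - 1) := by
    intro hT
    unfold honestFactor
    rw [h (A.T + 1) (by omega), factor_congr A N.graph (by omega) fun i hi => h (i + 1) (by omega)]
  have h4 : (if A.T < t ∧ t < A.T + 1 + A.κ then honestFactor A N σ.2.1 c (t - A.T - 1) else 0) =
      if A.T < t ∧ t < A.T + 1 + A.κ then honestFactor A N σ.2.1 c' (t - A.T - 1) else 0 := by
    split_ifs with h3
    · exact h2 h3.1
    · rfl
  have h5 : coinAt (fun i : Fin A.R => honestCoeff A N σ.2.1 c i v - σ.1 i v) t =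
      coinAt (fun i : Fin A.R => honestCoeff A N σ.2.1 c' i v - σ.1 i v) t := by
    rw [coinAt, coinAt, dif_pos ht', dif_pos ht', h1]
  unfold honestMsgs honestBase assemble
  rw [if_pos ht', if_pos ht', h t le_rfl, h4, h5, if_neg ht.ne, if_neg ht.ne]

lemma honestMsgs_coin (A : Scheme) (N : Network n ℕ) (σ : HonestSeed F n A.R) (c : ℕ → F)
    (u : Fin n) {t : ℕ} (ht : t < A.R) : honestMsgs A N σ c u t 0 = c t :=
  assemble_coin A _ _ _ _ _ _ _ ht

lemma honestMsgs_last (A : Scheme) (N : Network n ℕ) (σ : HonestSeed F n A.R) (c : ℕ → F)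
    (u : Fin n) : honestMsgs A N σ c u (A.R - 1) 5 =
      treeMask σ.2.2 u + honestSum A N σ.1 σ.2.1 c u :=
  assemble_last A _ _ _ _ _ _ _

lemma fingerprint_honestMsgs (A : Scheme) (N : Network n ℕ) (σ : HonestSeed F n A.R) (c : ℕ → F)
    (u : Fin n) : fingerprint A (honestMsgs A N σ c u) =
      ∑ t ∈ range (A.R - 1), c t * c (A.R - 1) ^ t :=
  fingerprint_assemble A _ _ _ _ _ _ _

lemma honestSum_eq (A : Scheme) (N : Network n ℕ) (s M : Fin A.R → Fin n → F) (c : ℕ → F)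
    (v : Fin n) (w S : F) : honestSum A N s M c v =
      localSum A c ((N.label v * A.aut : ℕ) : F) v (adjRow N.graph v)
        (honestBase A N s M c v w S) + childSum N (honestSum A N s M c) v := by
  rw [honestBase, localSum_assemble A _ _ _ _ _ w S 0 0]
  exact subtreeSum_eq N _ v

open Classical in
lemma childSum_eq_inbox (A : Scheme) (N : Network n ℕ) (D : Fin n → Messages F) (v : Fin n) :
    ∑ u, ((if N.graph.Adj u v then some (nodeMsg A (N.input u) (D u) v) else none).map
      (· 0)).getD 0 = childSum N (fun u => D u (A.R - 1) 5) v := by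
  refine Finset.sum_congr rfl fun u _ => ?_
  unfold childFlag
  by_cases h : N.graph.Adj u v
  · rw [if_pos h, if_pos h, ite_mul, one_mul, zero_mul]
    change (if v = N.parent u then D u (A.R - 1) 5 else 0) = _
    congr
  · rw [if_neg h, if_neg h, zero_mul]
    rfl

variable [NeZero n]

/-- The honest prover. -/
def honestProver [Fintype F] (A : Scheme) (C : Codec F ℓ 6) (N : Network n ℕ) : Prover n ℓ where
  Seed := HonestSeed F n A.R
  strategy σ L v := C.enc (honestMsgs A N σ
    (fun i => if h : i < L.length then C.dec (L[i] 0) 0 else 0) v (L.length - 1))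

lemma strategy_honestProver [Fintype F] (A : Scheme) (C : Codec F ℓ 6) (N : Network n ℕ)
    (σ : HonestSeed F n A.R) (κ : Fin A.R → F) (v : Fin n) {t : ℕ} (ht : t < A.R) :
    (honestProver A C N).strategy σ ((List.range (t + 1)).map (respAt C (coinAt κ))) v =
      C.enc (honestMsgs A N σ (coinAt κ) v t) := by
  have e : (fun i => if h : i < ((List.range (t + 1)).map (respAt (n := n) C (coinAt κ))).length
      then C.dec ((((List.range (t + 1)).map (respAt (n := n) C (coinAt κ)))[i]) 0) 0 else 0) =
        fun i => if i < t + 1 then coinAt κ i else 0 := by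
    funext i
    simp [respAt, C.dec_enc]
  simp only [honestProver]
  rw [e]
  congr 1
  simp only [List.length_map, List.length_range, Nat.add_sub_cancel]
  -- The prover extends the coins seen so far by zeros. In the last round nothing is missing, as
  -- `coinAt` is zero from `R` on.
  by_cases h : t < A.R - 1
  · exact honestMsgs_congr A N σ v h fun i hi => by simp [Nat.lt_succ_of_le hi]
  · congr 1
    funext i
    split_ifs with hi
    · rfl
    · rw [coinAt, dif_neg (by omega)]

lemma messagesOf_honestProver [Fintype F] (A : Scheme) (C : Codec F ℓ 6) (N : Network n ℕ)
    (σ : HonestSeed F n A.R) (κ : Fin A.R → F) :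
    messagesOf A C (honestProver A C N) σ (coinAt κ) = honestMsgs A N σ (coinAt κ) := by
  funext v t
  unfold messagesOf
  split_ifs with ht
  · rw [strategy_honestProver A C N σ κ v ht, C.dec_enc]
  · rw [honestMsgs, honestBase, assemble_of_le A _ _ _ _ _ _ _ (by omega)]

/-- The value at the root is the total over all nodes, a weighted sum of equations that all hold by
`eqns_of_honest`. -/
lemma honestSum_root (A : Scheme) (hκ : 0 < A.κ) (hκn : A.κ < n) (hn : n ≤ 2 ^ A.m) (hT : 0 < A.T)
    (N : Network n ℕ) (hN : N.label 0 * A.aut = tupleCount A.pat (A.κ + 1) N.graph)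
    (s M : Fin A.R → Fin n → F) (c : ℕ → F) : honestSum A N s M c 0 = 0 := by
  have hR : A.R = A.T + A.κ + 2 := rfl
  rw [honestSum, subtreeSum_root]
  unfold localSum
  rw [Finset.sum_comm]
  refine Finset.sum_eq_zero fun j hj => ?_
  rw [← Finset.mul_sum]
  set D : Fin n → Messages F := fun v => honestBase A N s M c v 0 0 with hD
  have hmask : ∀ i < A.R, sharedMask D i = honestMask M i := by
    intro i hi
    exact Finset.sum_congr rfl fun u _ => assemble_mask A _ _ _ _ _ _ _ hi
  have hround : ∀ t ≤ A.T, roundFun A N.graph (sharedMask D) t (fun i => c (i + 1)) =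
      roundFun A N.graph (honestMask M) t (fun i => c (i + 1)) := by
    intro t ht
    funext z
    exact roundFun_congr A N.graph (fun i hi => rfl) (fun _ i hi => hmask i (by omega)) z
  rw [eqns_of_honest A hκ hn hT N.graph c (fun u => ((N.label u * A.aut : ℕ) : F)) D
    (by rw [hN]) _ _ j (mem_range.1 hj), mul_zero]
  · intro t ht z
    have ht' : t < A.R := by omega
    rw [hround t ht, ← polyCoeff_spec (roundFun_coeffs A hκn N.graph (honestMask M) t _) z]
    simp only [sharedFun, piece, hD, honestBase, assemble_share A _ _ _ _ _ _ _ ht',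
      assemble_share' A _ _ _ _ _ _ _ ht', coinAt, ht', dite_true, sub_mul,
      Finset.sum_add_distrib, Finset.sum_sub_distrib]
    -- The rotation permutes the nodes, so the random parts of the two kinds of shares cancel.
    rw [Equiv.sum_comp (finRotate n) fun u => s ⟨t, ht'⟩ u * z ^ (u : ℕ), sub_add_cancel]
    rfl
  · intro i hi
    rw [hmask i (by omega)]
    simp only [hD, honestBase, maskedFactor_assemble A _ _ _ _ _ _ _ hi]
    rfl

open Classical in
lemma nodeAccepts_honest (A : Scheme) (hκ : 0 < A.κ) (hκn : A.κ < n) (hn : n ≤ 2 ^ A.m)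
    (hT : 0 < A.T) (N : Network n ℕ)
    (hbound : tupleCount A.pat (A.κ + 1) N.graph ≤ A.bound)
    (hlab : ∀ v, N.label v = N.label 0)
    (hN : N.label 0 * A.aut = tupleCount A.pat (A.κ + 1) N.graph)
    (σ : HonestSeed F n A.R) (κ : Fin n → Fin A.R → F) (v : Fin n) :
    NodeAccepts A (N.input v) (coinAt (κ v)) (honestMsgs A N σ (coinAt (κ 0)) v)
      fun u => if N.graph.Adj u v then
        some (nodeMsg A (N.input u) (honestMsgs A N σ (coinAt (κ 0)) u) v) else none := by
  have hR : A.R = A.T + A.κ + 2 := rfl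
  have hlt : A.R - 1 < A.R := by omega
  set c : ℕ → F := coinAt (κ 0) with hc
  have hmem : ∀ {u x}, (if N.graph.Adj u v then
      some (nodeMsg A (N.input u) (honestMsgs A N σ c u) v) else none) = some x →
      nodeMsg A (N.input u) (honestMsgs A N σ c u) v = x := by
    intro u x h
    split_ifs at h
    exact Option.some.inj h
  refine ⟨?_, ?_, ?_, ?_, ?_, ?_, ?_⟩
  · simp only [Network.input]
    rw [hlab v, hN]
    exact hbound
  · intro h t ht
    obtain rfl : v = 0 := Fin.ext h
    exact honestMsgs_coin A N σ c 0 ht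
  · intro h
    obtain rfl : v = 0 := Fin.ext h
    rw [honestMsgs_last, honestSum_root A hκ hκn hn hT N hN, treeMask, if_pos (by simp), add_zero]
  · rintro u x hx
    rw [← hmem hx, honestMsgs_coin A N σ c v hlt]
    exact honestMsgs_coin A N σ c u hlt
  · rintro u x hx
    rw [← hmem hx, fingerprint_honestMsgs]
    exact fingerprint_honestMsgs A N σ c u
  · rintro u x hx
    rw [← hmem hx]
    change ((N.label u * A.aut : ℕ) : F) = ((N.label v * A.aut : ℕ) : F)
    rw [hlab u, hlab v]
  -- The tree masks satisfy the same recursion as the subtree sums, with `w` in place of the local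
  -- sum; adding the two recursions gives the test of the node.
  · have h1 : (fun t => honestMsgs A N σ c v t 0) = c := by
      funext t
      by_cases ht : t < A.R
      · exact honestMsgs_coin A N σ c v ht
      · rw [honestMsgs, honestBase, assemble_of_le A _ _ _ _ _ _ _ (by omega), hc, coinAt,
          dif_neg ht, Pi.zero_apply]
    have h2 : honestMsgs A N σ c v 0 5 = treeMask σ.2.2 v - childSum N (treeMask σ.2.2) v := by
      rw [honestMsgs, honestBase, assemble_first]
    rw [isSome_inbox_eq_adjRow, childSum_eq_inbox, h1, h2]
    simp only [honestMsgs_last, childSum_add]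
    have h3 := honestSum_eq A N σ.1 σ.2.1 c v (treeMask σ.2.2 v - childSum N (treeMask σ.2.2) v)
      (treeMask σ.2.2 v + honestSum A N σ.1 σ.2.1 c v)
    rw [h3]
    simp only [honestMsgs, Network.input]
    ring

/-- All nodes accept the honest prover. -/
lemma allAccept_honest [Fintype F] (A : Scheme) (hκ : 0 < A.κ) (hκn : A.κ < n) (hn : n ≤ 2 ^ A.m)
    (hT : 0 < A.T) (C : Codec F ℓ 6) (C' : Codec F b 4) (N : Network n ℕ)
    (hbound : tupleCount A.pat (A.κ + 1) N.graph ≤ A.bound)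
    (hlab : ∀ v, N.label v = N.label 0)
    (hN : N.label 0 * A.aut = tupleCount A.pat (A.κ + 1) N.graph)
    (ω : Randomness (verifier n A C C') (honestProver A C N)) :
    AllAccept (verifier n A C C') (honestProver A C N) N (2 * A.R) 1 ω := by
  rw [allAccept_iff]
  intro v
  rw [messagesOf_honestProver A C N ω.1 (ω.2 0)]
  exact nodeAccepts_honest A hκ hκn hn hT N hbound hlab hN ω.1 ω.2 v

end Honest

/-! ### Zero knowledge -/

section Uniform

open Classical in
/-- A map all of whose fibres have the same size maps the uniform distribution to the uniform
distribution. -/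
lemma map_uniform_of_fibres {α β : Type} [Fintype α] [Nonempty α] [Fintype β] [Nonempty β]
    (f : α → β) (h : ∀ y, (univ.filter fun a => f a = y).card * Fintype.card β = Fintype.card α) :
    (PMF.uniformOfFintype α).map f = PMF.uniformOfFintype β := by
  refine PMF.ext fun y => ?_
  have hα : (Fintype.card α : ENNReal) ≠ 0 := by exact_mod_cast Fintype.card_ne_zero
  rw [PMF.map_apply, tsum_fintype, PMF.uniformOfFintype_apply]
  simp only [PMF.uniformOfFintype_apply]
  rw [← Finset.sum_filter, Finset.sum_const, nsmul_eq_mul]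
  have h1 : (univ.filter fun a => y = f a) = univ.filter fun a => f a = y :=
    Finset.filter_congr fun a _ => eq_comm
  rw [h1]
  refine ENNReal.eq_inv_of_mul_eq_one_left ?_
  rw [mul_right_comm, ← Nat.cast_mul, h y]
  exact ENNReal.mul_inv_cancel hα (ENNReal.natCast_ne_top _)

lemma map_uniform_of_bijective {α : Type} [Fintype α] [Nonempty α] {f : α → α}
    (hf : Bijective f) : (PMF.uniformOfFintype α).map f = PMF.uniformOfFintype α := by
  classical
  refine map_uniform_of_fibres f fun y => ?_
  obtain ⟨a, ha, huniq⟩ := hf.existsUnique y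
  have : (univ.filter fun a => f a = y) = {a} := by
    ext b
    simp only [mem_filter, mem_univ, true_and, mem_singleton]
    exact ⟨fun hb => huniq b hb, fun hb => hb ▸ ha⟩
  rw [this, card_singleton, one_mul]

lemma map_uniform_eval {ι X : Type} [Fintype ι] [DecidableEq ι] [Fintype X] [Nonempty X] (v : ι) :
    (PMF.uniformOfFintype (ι → X)).map (fun κ => κ v) = PMF.uniformOfFintype X := by
  classical
  refine map_uniform_of_fibres _ fun y => ?_
  have h1 : (univ.filter fun κ : ι → X => κ v = y).card =
      Fintype.card ({j // j ≠ v} → X) := by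
    rw [← Fintype.card_subtype]
    refine Fintype.card_congr ?_
    exact
      { toFun := fun κ j => κ.1 j
        invFun := fun g => ⟨fun j => if h : j = v then y else g ⟨j, h⟩, by simp⟩
        left_inv := by
          rintro ⟨κ, hκ⟩
          ext j
          by_cases h : j = v
          · subst h
            simp [hκ]
          · simp [h]
        right_inv := by
          intro g
          funext j
          simp [j.2] }
  rw [h1, Fintype.card_congr (Equiv.funSplitAt v X), Fintype.card_prod, mul_comm]

end Uniform

/-! ### The simulator and its comparison with the view of a node -/

section Simulator

variable {F : Type} [Field F] {n ℓ b : ℕ} [NeZero n]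

/-- The sequences drawn by the simulator. -/
abbrev SimCoin (F : Type) (n R : ℕ) : Type := HonestSeed F n R × (Fin n → Fin R → F)

/-- The simulated messages to node `v`, up to the mask `w` and the sum `S`. -/
def simBase (A : Scheme) (o : SimCoin F n A.R) (v : Fin n) (w S : F) : Messages F :=
  assemble A (coinAt (o.2 0)) (coinAt fun i => o.1.1 i v) (coinAt fun i => o.1.1 i (finRotate n v))
    (coinAt fun i => o.1.2.1 i v) (coinAt fun i => o.1.2.1 i (finRotate n v)) w S

/-- The simulated messages to a node whose neighbours are given by `nbr` and whose children are
given by the indicator function `fl`. -/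
def simMsgs (A : Scheme) (inp : LocalInput n ℕ) (nbr : Fin n → Bool) (fl : Fin n → F)
    (o : SimCoin F n A.R) : Messages F :=
  simBase A o inp.id
    (treeMask o.1.2.2 inp.id - localSum A (coinAt (o.2 0)) ((inp.label * A.aut : ℕ) : F) inp.id nbr
      (simBase A o inp.id 0 0) - ∑ u, fl u * treeMask o.1.2.2 u)
    (treeMask o.1.2.2 inp.id)

/-- The simulated view. -/
def simView (A : Scheme) (C : Codec F ℓ 6) (C' : Codec F b 4) (inp : LocalInput n ℕ)
    (nbr : Fin n → Bool) (fl : Fin n → F) (o : SimCoin F n A.R) : View n ℓ b (Fin A.R → F) where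
  coin := o.2 inp.id
  fromProver := (List.range A.R).map fun t => C.enc (simMsgs A inp nbr fl o t)
  fromNeighbors := [fun u => if nbr u then
    some (C'.enc ![fl u * treeMask o.1.2.2 u, coinAt (o.2 0) (A.R - 1),
      ∑ t ∈ range (A.R - 1), coinAt (o.2 0) t * coinAt (o.2 0) (A.R - 1) ^ t,
      ((inp.label * A.aut : ℕ) : F)]) else none]

/-- The simulator: the nodes tell their neighbours whether they are their children. -/
def simulator (n : ℕ) [NeZero n] [Fintype F] (A : Scheme) (C : Codec F ℓ 6) (C' : Codec F b 4) :
    Simulator n b ℕ (View n ℓ b (verifier n A C C').Coin) where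
  Coin := SimCoin F n A.R
  alg :=
    { send := fun d _ v => C'.enc fun _ => if v = d.1.parent then 1 else 0
      out := fun d L => simView A C C' d.1 (fun u => (L.headD (fun _ => none) u).isSome)
        (fun u => ((L.headD (fun _ => none) u).map fun x => C'.dec x 0).getD 0) d.2 }

/-- The single round of communication only tells a node its neighbours and its children. All random
values, including those it attributes to other nodes, are its own. -/
lemma run_simulator [Fintype F] (A : Scheme) (C : Codec F ℓ 6) (C' : Codec F b 4)
    (N : Network n ℕ) (κ : Fin n → SimCoin F n A.R) (v : Fin n) :
    (simulator n A C C').alg.run 1 N.graph (fun u => (N.input u, κ u)) v =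
      simView A C C' (N.input v) (adjRow N.graph v) (childFlag N v) (κ v) := by
  classical
  have h1 : (fun u => (if N.graph.Adj u v then
      some (C'.enc fun _ => if v = N.parent u then (1 : F) else 0) else none).isSome) =
        adjRow N.graph v := isSome_inbox_eq_adjRow N.graph v _
  have h2 : (fun u => ((if N.graph.Adj u v then
      some (C'.enc fun _ => if v = N.parent u then (1 : F) else 0) else none).map
        fun x => C'.dec x 0).getD 0) = childFlag N v := by
    funext u
    unfold childFlag
    by_cases h : N.graph.Adj u v
    · rw [if_pos h, if_pos h, Option.map_some, Option.getD_some, C'.dec_enc]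
    · rw [if_neg h, if_neg h]
      rfl
  rw [← h1, ← h2]
  unfold LocalAlg.run
  simp only [LocalAlg.received, List.nil_append]
  simp only [simulator, Network.input, List.headD_cons]
  congr!

/-- The bijection between the randomness of the protocol and of the simulator for node `v`. -/
def reveal (A : Scheme) (N : Network n ℕ) (v : Fin n) (o : SimCoin F n A.R) : SimCoin F n A.R :=
  ((fun i u => if u = v then honestCoeff A N o.1.2.1 (coinAt (o.2 0)) i v - o.1.1 i v
      else o.1.1 i u,
    fun i u => if u = finRotate n v ∧ (i : ℕ) < A.κ then
      honestFactor A N o.1.2.1 (coinAt (o.2 0)) i else o.1.2.1 i u,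
    fun u => o.1.2.2 u + honestSum A N o.1.1 o.1.2.1 (coinAt (o.2 0)) u), o.2)

/-- The map is triangular. The coins are unchanged; the masks are recovered because a masked factor
contains the overwritten mask with a nonzero coefficient `nz`; coins and masks determine the
coefficients, hence the shares; and these determine the subtree sums by which the tree masks are
translated. -/
lemma reveal_injective (A : Scheme) (N : Network n ℕ) (v : Fin n) :
    Injective (reveal A N v : SimCoin F n A.R → SimCoin F n A.R) := by
  rintro ⟨⟨s, M, m⟩, κ⟩ ⟨⟨s', M', m'⟩, κ'⟩ h
  simp only [reveal, Prod.mk.injEq] at h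
  obtain ⟨⟨h1, h2, h3⟩, rfl⟩ := h
  have hoff : ∀ (i : Fin A.R) (u : Fin n), ¬ (u = finRotate n v ∧ (i : ℕ) < A.κ) →
      M i u = M' i u := by
    intro i u hu
    have := congrFun (congrFun h2 i) u
    rwa [if_neg hu, if_neg hu] at this
  have hM : M = M' := by
    funext i u
    by_cases hu : u = finRotate n v ∧ (i : ℕ) < A.κ
    · have := congrFun (congrFun h2 i) u
      rw [if_pos hu, if_pos hu, honestFactor, honestFactor] at this
      have h4 := mul_left_cancel₀ (nz_ne_zero _) (add_left_cancel this)
      simp only [honestMask, coinAt, i.2, dite_true] at h4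
      rw [← Finset.add_sum_erase _ _ (mem_univ u), ← Finset.add_sum_erase _ _ (mem_univ u)] at h4
      rw [Finset.sum_congr rfl fun w hw => hoff i w fun hc =>
        (Finset.ne_of_mem_erase hw) (hc.1.trans hu.1.symm)] at h4
      exact add_right_cancel h4
    · exact hoff i u hu
  subst hM
  have hs : s = s' := by
    funext i u
    have := congrFun (congrFun h1 i) u
    by_cases hu : u = v
    · rw [if_pos hu, if_pos hu] at this
      rw [hu]
      exact sub_right_injective this
    · rwa [if_neg hu, if_neg hu] at this
  subst hs
  have hm : m = m' := by
    funext u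
    exact add_right_cancel (congrFun h3 u)
  rw [hm]

lemma assemble_congr (A : Scheme) (c a a' μ : ℕ → F) {y y' : ℕ → F} (w S : F)
    (h : ∀ i < A.κ, y i = y' i) : assemble A c a a' μ y w S = assemble A c a a' μ y' w S := by
  funext t
  have : (if A.T < t ∧ t < A.T + 1 + A.κ then y (t - A.T - 1) else 0) =
      if A.T < t ∧ t < A.T + 1 + A.κ then y' (t - A.T - 1) else 0 := by
    split_ifs with ht
    · exact h _ (by omega)
    · rfl
  unfold assemble
  rw [this]

lemma finRotate_ne_self (hn : 2 ≤ n) (v : Fin n) : finRotate n v ≠ v := by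
  obtain ⟨m, rfl⟩ : ∃ m, n = m + 2 := ⟨n - 2, by omega⟩
  rw [finRotate_apply]
  intro h
  simp at h

/-- Node `v` sees the first share and the mask share stored at `v`, and the second share stored at
its rotation. The slot of a mask at the rotation is not seen by `v`, so it is free to hold the
masked factor. For `n ≥ 2` the two positions differ. -/
lemma simBase_reveal (A : Scheme) (hn : 2 ≤ n) (N : Network n ℕ) (v : Fin n)
    (o : SimCoin F n A.R) (w S : F) :
    simBase A (reveal A N v o) v w S =
      honestBase A N o.1.1 o.1.2.1 (coinAt (o.2 0)) v w S := by
  have hR : A.R = A.T + A.κ + 2 := rfl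
  have hne := finRotate_ne_self hn v
  have e1 : (fun i => (reveal A N v o).1.1 i v) = fun i : Fin A.R =>
      honestCoeff A N o.1.2.1 (coinAt (o.2 0)) i v - o.1.1 i v := by
    funext i
    exact if_pos rfl
  have e2 : (fun i => (reveal A N v o).1.1 i (finRotate n v)) =
      fun i => o.1.1 i (finRotate n v) := by
    funext i
    exact if_neg hne
  have e3 : (fun i => (reveal A N v o).1.2.1 i v) = fun i => o.1.2.1 i v := by
    funext i
    exact if_neg fun h => hne h.1.symm
  unfold simBase honestBase
  rw [e1, e2, e3]
  refine assemble_congr A _ _ _ _ w S fun i hi => ?_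
  rw [coinAt, dif_pos (by omega)]
  exact if_pos ⟨rfl, hi⟩

/-- At the root the mask is forced to be zero; the translation respects this because the honest sum
vanishes there. -/
lemma treeMask_reveal (A : Scheme) (hκ : 0 < A.κ) (hκn : A.κ < n) (hn : n ≤ 2 ^ A.m)
    (hT : 0 < A.T) (N : Network n ℕ)
    (hN : N.label 0 * A.aut = tupleCount A.pat (A.κ + 1) N.graph) (v : Fin n)
    (o : SimCoin F n A.R) (u : Fin n) : treeMask (reveal A N v o).1.2.2 u =
      treeMask o.1.2.2 u + honestSum A N o.1.1 o.1.2.1 (coinAt (o.2 0)) u := by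
  unfold treeMask
  split_ifs with h
  · obtain rfl : u = 0 := Fin.ext h
    rw [honestSum_root A hκ hκn hn hT N hN, add_zero]
  · rfl

/-- The simulator draws the subtree sums of the node and its children and solves the test of the
node for `w`. The recursion of the honest sums shows that this is the honest value. -/
lemma simMsgs_reveal (A : Scheme) (hκ : 0 < A.κ) (hκn : A.κ < n) (hn : n ≤ 2 ^ A.m)
    (hT : 0 < A.T) (N : Network n ℕ)
    (hN : N.label 0 * A.aut = tupleCount A.pat (A.κ + 1) N.graph) (v : Fin n)
    (o : SimCoin F n A.R) :
    simMsgs A (N.input v) (adjRow N.graph v) (childFlag N v) (reveal A N v o) =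
      honestMsgs A N o.1 (coinAt (o.2 0)) v := by
  have hmask := treeMask_reveal A hκ hκn hn hT N hN v o
  have h1 := honestSum_eq A N o.1.1 o.1.2.1 (coinAt (o.2 0)) v 0 0
  have h2 : (∑ u, childFlag N v u * treeMask (reveal A N v o).1.2.2 u) =
      childSum N (treeMask o.1.2.2) v +
        childSum N (honestSum A N o.1.1 o.1.2.1 (coinAt (o.2 0))) v := by
    rw [← childSum_add]
    exact Finset.sum_congr rfl fun u _ => by rw [hmask u]
  have h3 : (reveal A N v o).2 = o.2 := rfl
  unfold simMsgs honestMsgs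
  simp only [Network.input]
  rw [h2, h3, hmask v, simBase_reveal A (by omega), simBase_reveal A (by omega)]
  congr 1
  linear_combination h1

open Classical in
lemma simView_reveal (A : Scheme) (hκ : 0 < A.κ) (hκn : A.κ < n) (hn : n ≤ 2 ^ A.m)
    (hT : 0 < A.T) (C : Codec F ℓ 6) (C' : Codec F b 4) (N : Network n ℕ)
    (hlab : ∀ v, N.label v = N.label 0)
    (hN : N.label 0 * A.aut = tupleCount A.pat (A.κ + 1) N.graph) (v : Fin n)
    (o : SimCoin F n A.R) :
    simView A C C' (N.input v) (adjRow N.graph v) (childFlag N v) (reveal A N v o) =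
      ⟨o.2 v, (List.range A.R).map fun t => C.enc (honestMsgs A N o.1 (coinAt (o.2 0)) v t),
        [fun u => if N.graph.Adj u v then
          some (C'.enc (nodeMsg A (N.input u) (honestMsgs A N o.1 (coinAt (o.2 0)) u) v))
          else none]⟩ := by
  have hR : A.R = A.T + A.κ + 2 := rfl
  have hlt : A.R - 1 < A.R := by omega
  unfold simView
  rw [simMsgs_reveal A hκ hκn hn hT N hN]
  congr 2
  funext u
  by_cases h : N.graph.Adj u v
  · have h' : adjRow N.graph v u = true := by
      unfold adjRow
      exact decide_eq_true h.symm
    have hflag : (if v = N.parent u then treeMask (reveal A N v o).1.2.2 u else 0) =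
        childFlag N v u * treeMask (reveal A N v o).1.2.2 u := by
      rw [childFlag, if_pos h, ite_mul, one_mul, zero_mul]
    have hcoins : (reveal A N v o).2 = o.2 := rfl
    rw [hcoins, if_pos h, if_pos h', nodeMsg, honestMsgs_coin A N _ _ u hlt, fingerprint_honestMsgs,
      honestMsgs_last, ← treeMask_reveal A hκ hκn hn hT N hN v o u, ← hflag]
    simp only [Network.input]
    rw [hlab u, ← hlab v]
    congr!
  · have h' : ¬ adjRow N.graph v u = true := by
      unfold adjRow
      simpa using fun hc => h (SimpleGraph.Adj.symm hc)
    rw [if_neg h, if_neg h']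

lemma view_eq [Fintype F] (A : Scheme) (hκ : 0 < A.κ) (hκn : A.κ < n) (hn : n ≤ 2 ^ A.m)
    (hT : 0 < A.T) (C : Codec F ℓ 6) (C' : Codec F b 4) (N : Network n ℕ)
    (hlab : ∀ v, N.label v = N.label 0)
    (hN : N.label 0 * A.aut = tupleCount A.pat (A.κ + 1) N.graph) (v : Fin n)
    (ω : Randomness (verifier n A C C') (honestProver A C N)) :
    (⟨ω.2 v, (interact (verifier n A C C') (honestProver A C N) N (2 * A.R) ω (2 * A.R)).toNode v,
      (verifier n A C C').verify.received N.graph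
        (verifyInput (verifier n A C C') (honestProver A C N) N (2 * A.R) ω) 1 v⟩ :
        View n ℓ b (verifier n A C C').Coin) =
      simView A C C' (N.input v) (adjRow N.graph v) (childFlag N v) (reveal A N v ω) := by
  rw [received_verifier, toNode_eq, messagesOf_honestProver A C N ω.1 (ω.2 0)]
  refine Eq.trans ?_ (simView_reveal A hκ hκn hn hT C C' N hlab hN v ω).symm
  congr 1
  refine List.map_congr_left fun t ht => ?_
  exact strategy_honestProver A C N ω.1 (ω.2 0) v (List.mem_range.1 ht)

/-- The output of the simulator has the distribution of the view. -/
lemma simDist_eq_viewDist [Fintype F] (A : Scheme) (hκ : 0 < A.κ) (hκn : A.κ < n)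
    (hn : n ≤ 2 ^ A.m) (hT : 0 < A.T) (C : Codec F ℓ 6) (C' : Codec F b 4) (N : Network n ℕ)
    (hlab : ∀ v, N.label v = N.label 0)
    (hN : N.label 0 * A.aut = tupleCount A.pat (A.κ + 1) N.graph) (v : Fin n) :
    simDist (simulator n A C C') N 1 v =
      viewDist (verifier n A C C') (honestProver A C N) N (2 * A.R) 1 v := by
  have h1 : simDist (simulator n A C C') N 1 v =
      (PMF.uniformOfFintype (SimCoin F n A.R)).map
        (simView A C C' (N.input v) (adjRow N.graph v) (childFlag N v)) := by
    -- The output at `v` depends on the coins of `v` alone, so the other nodes can be dropped.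
    rw [← map_uniform_eval (ι := Fin n) (X := SimCoin F n A.R) v, PMF.map_comp]
    unfold simDist
    congr 1
    funext κ
    exact run_simulator A C C' N κ v
  have h2 : viewDist (verifier n A C C') (honestProver A C N) N (2 * A.R) 1 v =
      (PMF.uniformOfFintype (SimCoin F n A.R)).map
        (simView A C C' (N.input v) (adjRow N.graph v) (childFlag N v) ∘ reveal A N v) := by
    unfold viewDist
    congr 1
    funext ω
    exact view_eq A hκ hκn hn hT C C' N hlab hN v ω
  rw [h1, h2, ← PMF.map_comp, map_uniform_of_bijective
    (Finite.injective_iff_bijective.1 (reveal_injective A N v))]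

end Simulator

/-! ### Protocols for a fixed number of nodes -/

/-- There is a perfect zero-knowledge protocol for the networks with `n` nodes. -/
def HasProtocol (n r ℓ b : ℕ) (L : Set (Network n ℕ)) : Prop :=
  ∃ (V : Verifier n ℓ b ℕ) (honest : Network n ℕ → Prover n ℓ)
    (S : Simulator n b ℕ (View n ℓ b V.Coin)),
    (∀ N ∈ L, 2 / 3 ≤ acceptProb V (honest N) N r 1) ∧
    (∀ N ∉ L, ∀ P : Prover n ℓ, acceptProb V P N r 1 ≤ 1 / 3) ∧
    (∀ N ∈ L, ∀ v, simDist S N 1 v = viewDist V (honest N) N r 1 v)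

lemma two_thirds_le_acceptProb {n ℓ b r : ℕ} {V : Verifier n ℓ b ℕ} {P : Prover n ℓ}
    {N : Network n ℕ} (h : ∀ ω, AllAccept V P N r 1 ω) : 2 / 3 ≤ acceptProb V P N r 1 := by
  have h1 : {ω | AllAccept V P N r 1 ω} = Set.univ := Set.eq_univ_of_forall h
  have h2 : acceptProb V P N r 1 = 1 := by
    unfold acceptProb
    rw [h1, PMF.toOuterMeasure_apply_eq_one_iff]
    exact Set.subset_univ _
  rw [h2]
  exact ENNReal.div_le_of_le_mul (by norm_num)

/-- A language which consists of the networks with constant label `c` needs no interaction. -/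
lemma hasProtocol_const (n c : ℕ) (L : Set (Network n ℕ))
    (hL : ∀ N, N ∈ L ↔ ∀ v, N.label v = c) : HasProtocol n 0 0 0 L := by
  classical
  refine ⟨{ Coin := Unit
            respond := fun _ _ _ => default
            verify :=
              { send := fun _ _ _ => default
                out := fun d _ => decide (d.1.label = c) } },
    fun _ => { Seed := Unit, strategy := fun _ _ _ => default },
    { Coin := Unit
      alg :=
        { send := fun _ _ _ => default
          out := fun _ R => ⟨(), [], R⟩ } }, ?_, ?_, ?_⟩
  · intro N hN
    refine two_thirds_le_acceptProb fun ω v => ?_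
    exact decide_eq_true ((hL N).1 hN v)
  · intro N hN P
    rw [hL] at hN
    refine le_of_eq_of_le ?_ zero_le
    unfold acceptProb
    rw [PMF.toOuterMeasure_apply_eq_zero_iff, Set.disjoint_left]
    intro ω _ hω
    exact hN fun v => of_decide_eq_true (hω v)
  · intro N _ v
    unfold simDist viewDist
    have key : ∀ {α β : Type} (p : PMF α) (f : α → β) (y : β), (∀ x, f x = y) →
        p.map f = PMF.pure y := fun p f y h => by
      rw [show f = Function.const _ y from funext h, PMF.map_const]
    rw [key _ _ ⟨(), [], [fun u => if N.graph.Adj u v then some default else none]⟩ fun _ => ?_,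
      key _ _ ⟨(), [], [fun u => if N.graph.Adj u v then some default else none]⟩ fun _ => ?_]
    · rfl
    · rfl

/-- A protocol for the networks whose label is the number of valid tuples, divided by `aut`. -/
lemma hasProtocol_tupleCount {n k q s : ℕ} [Fact q.Prime] (hk : 2 ≤ k) (hkn : k ≤ n)
    (pat : ℕ → ℕ → Bool → Bool) {aut : ℕ} (haut : 0 < aut) (hq : n ^ k < q)
    (hq' : 3 * ((k * Nat.clog 2 n + 1) * n + n * (k * Nat.clog 2 n + k + 1) +
      (k * Nat.clog 2 n + k + 2)) ≤ q) (hs : q ≤ 2 ^ s) (L : Set (Network n ℕ))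
    (hL : ∀ N, N ∈ L ↔ ∃ Δ : ℕ, (∀ v, N.label v = Δ) ∧ Δ * aut = tupleCount pat k N.graph) :
    HasProtocol n (2 * (k * Nat.clog 2 n + k + 1)) (6 * s) (4 * s) L := by
  obtain ⟨κ, rfl⟩ : ∃ κ, k = κ + 1 := ⟨k - 1, by omega⟩
  have : NeZero n := ⟨by omega⟩
  set A : Scheme := ⟨κ, Nat.clog 2 n, pat, aut, n ^ (κ + 1)⟩ with hA
  have hm : 0 < Nat.clog 2 n := Nat.clog_pos (by norm_num) (by omega)
  have hAT : A.T = (κ + 1) * Nat.clog 2 n := rfl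
  have hAR : A.R = (κ + 1) * Nat.clog 2 n + (κ + 1) + 1 := rfl
  have hTle : κ + 1 ≤ A.T := by
    rw [hAT]
    exact Nat.le_mul_of_pos_right _ hm
  have hκ : 0 < A.κ := by change 0 < κ; omega
  have hκn : A.κ < n := by change κ < n; omega
  have hn : n ≤ 2 ^ A.m := Nat.le_pow_clog (by norm_num) n
  have hT : 0 < A.T := by omega
  have hκT : A.κ ≤ A.T := by change κ ≤ A.T; omega
  have hcard : Fintype.card (ZMod q) = q := ZMod.card q
  -- Both numbers are at most `n ^ k < q`, so equality modulo `q` is equality.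
  have hcast : ∀ a b : ℕ, a ≤ A.bound → b ≤ A.bound → (a : ZMod q) = b → a = b := by
    intro a b ha hb hab
    rw [ZMod.natCast_eq_natCast_iff'] at hab
    rwa [Nat.mod_eq_of_lt (lt_of_le_of_lt ha hq), Nat.mod_eq_of_lt (lt_of_le_of_lt hb hq)] at hab
  have hbound : ∀ G : SimpleGraph (Fin n), tupleCount A.pat (A.κ + 1) G ≤ A.bound :=
    fun G => tupleCount_le pat (κ + 1) G
  obtain ⟨C⟩ := exists_codec (F := ZMod q) (s := s) (w := 6) (by rw [hcard]; exact hs)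
  obtain ⟨C'⟩ := exists_codec (F := ZMod q) (s := s) (w := 4) (by rw [hcard]; exact hs)
  have hyes : ∀ N ∈ L, (∀ v, N.label v = N.label 0) ∧
      N.label 0 * A.aut = tupleCount A.pat (A.κ + 1) N.graph := by
    intro N hN
    obtain ⟨Δ, h1, h2⟩ := (hL N).1 hN
    exact ⟨fun v => (h1 v).trans (h1 0).symm, by rw [h1 0]; exact h2⟩
  rw [← hAR]
  refine ⟨verifier n A C C', fun N => honestProver A C N, simulator n A C C', ?_, ?_, ?_⟩
  · intro N hN
    exact two_thirds_le_acceptProb fun ω => allAccept_honest A hκ hκn hn hT C C' N (hbound _)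
      (hyes N hN).1 (hyes N hN).2 ω
  · intro N hN P
    refine acceptProb_le A hκ hκn hn hT hκT haut hcast ?_ C C' P N (hbound _) ?_
    · rw [hcard, hAT, hAR]
      exact hq'
    · rw [hL] at hN
      exact hN
  · intro N hN v
    exact simDist_eq_viewDist A hκ hκn hn hT C C' N (hyes N hN).1 (hyes N hN).2 v

/-! ### The theorem -/

/-- Rounding up costs at most `1 ≤ log x`, and `1 / log 2 < 2`; this is where `x ≥ 3 > e` enters. -/
lemma clog_le_log {x : ℕ} (hx : 3 ≤ x) : (Nat.clog 2 x : ℝ) ≤ 3 * Real.log x := by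
  have hx' : (3 : ℝ) ≤ x := by exact_mod_cast hx
  have h1 : (1 : ℝ) ≤ Real.log x := by
    rw [Real.le_log_iff_exp_le (by linarith)]
    linarith [Real.exp_one_lt_d9]
  have hpos : 0 < Nat.clog 2 x := Nat.clog_pos (by norm_num) (by omega)
  have h2 : 2 ^ (Nat.clog 2 x - 1) < x := Nat.pow_pred_clog_lt_self (by norm_num) (by omega)
  have h3 : ((Nat.clog 2 x - 1 : ℕ) : ℝ) * Real.log 2 ≤ Real.log x := by
    rw [← Real.log_pow]
    exact Real.log_le_log (by positivity) (by exact_mod_cast h2.le)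
  have h4 : ((Nat.clog 2 x - 1 : ℕ) : ℝ) = (Nat.clog 2 x : ℝ) - 1 := by
    rw [Nat.cast_sub hpos, Nat.cast_one]
  rw [h4] at h3
  have h5 := Real.log_two_gt_d9
  have h6 : (0 : ℝ) ≤ (Nat.clog 2 x : ℝ) - 1 := by
    have : (1 : ℝ) ≤ Nat.clog 2 x := by exact_mod_cast hpos
    linarith
  nlinarith

lemma tvDist_self {α : Type} (μ : PMF α) : tvDist μ μ = 0 := by
  simp [tvDist]

/-- A crude estimate of three times the numerator in the union bound; the exponent `6` only has to
be below the growth of `q` in both regimes. -/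
lemma soundness_bound {n k : ℕ} (hn : 4 ≤ n) (hk : k ≤ n) :
    3 * ((k * Nat.clog 2 n + 1) * n + n * (k * Nat.clog 2 n + k + 1) +
      (k * Nat.clog 2 n + k + 2)) ≤ n ^ 6 := by
  have hm : Nat.clog 2 n ≤ n := Nat.clog_le_of_le_pow Nat.lt_two_pow_self.le
  have h1 : k * Nat.clog 2 n ≤ n ^ 2 := by
    rw [pow_two]
    exact Nat.mul_le_mul hk hm
  calc 3 * ((k * Nat.clog 2 n + 1) * n + n * (k * Nat.clog 2 n + k + 1) +
      (k * Nat.clog 2 n + k + 2))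
      ≤ 3 * ((n ^ 2 + 1) * n + n * (n ^ 2 + n + 1) + (n ^ 2 + n + 2)) := by gcongr
    _ = 6 * n ^ 3 + 6 * n ^ 2 + 9 * n + 6 := by ring
    _ ≤ 64 * n ^ 3 := by nlinarith [Nat.pow_le_pow_left hn 2, Nat.pow_le_pow_left hn 3]
    _ ≤ n ^ 3 * n ^ 3 := Nat.mul_le_mul_right _ (Nat.pow_le_pow_left hn 3)
    _ = n ^ 6 := by ring

/-- Perfect zero-knowledge protocols for all `n` give membership in the class. -/
lemma dStatZK_of_hasProtocol {r ℓ b : ℕ → ℕ} {L : DistLanguage ℕ}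
    (h : ∀ n, HasProtocol n (r n) (ℓ n) (b n) (L n)) : DStatZK r ℓ ⟨1, b⟩ ⟨1, b⟩ L := by
  choose V honest S h1 h2 h3 using h
  refine ⟨V, honest, S, h1, h2, fun p => Filter.Eventually.of_forall fun n N hN v => ?_⟩
  rw [show simDist (S n) N 1 v = _ from h3 n N hN v, tvDist_self, mul_zero]
  exact zero_le_one

/-- Counting problems which reduce to counting valid tuples have the required protocols. -/
lemma exists_params (k q : ℕ → ℕ) (hq : ∀ n, (q n).Prime)
    (hkq : ((∃ B : ℕ, ∀ n, k n ≤ B) ∧ ∀ d : ℕ, ∀ᶠ n : ℕ in Filter.atTop, n ^ d < q n) ∨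
      (Filter.Tendsto k Filter.atTop Filter.atTop ∧ ∀ᶠ n : ℕ in Filter.atTop, n ^ k n < q n))
    (count : (n : ℕ) → SimpleGraph (Fin n) → ℕ) (pat : ℕ → ℕ → ℕ → Bool → Bool) (aut : ℕ → ℕ)
    (haut : ∀ n, 0 < aut n)
    (hcount : ∀ n G, count n G * aut n = tupleCount (pat n) (k n) G) (L : DistLanguage ℕ)
    (hL : ∀ n, L n = {N | ∃ Δ : ℕ, (∀ v, N.label v = Δ) ∧ count n N.graph = Δ}) :
    ∃ (r ℓ : ℕ → ℕ) (A : AlgClass),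
      (∀ᶠ n : ℕ in Filter.atTop, (r n : ℝ) ≤ (20 : ℕ) * (k n * Real.log n)) ∧
      (∀ᶠ n : ℕ in Filter.atTop, (ℓ n : ℝ) ≤ (20 : ℕ) * Real.log (q n)) ∧
      A.rounds ≤ 20 ∧
      (∀ᶠ n : ℕ in Filter.atTop, (A.bits n : ℝ) ≤ (20 : ℕ) * Real.log (q n)) ∧
      DStatZK r ℓ A A L := by
  classical
  let Good : ℕ → ℕ → Prop := fun n p => n ^ k n < p ∧
    3 * ((k n * Nat.clog 2 n + 1) * n + n * (k n * Nat.clog 2 n + k n + 1) +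
      (k n * Nat.clog 2 n + k n + 2)) ≤ p
  have hgood : ∀ᶠ n : ℕ in Filter.atTop, k n ≤ n → Good n (q n) := by
    have h1 : ∀ᶠ n : ℕ in Filter.atTop, n ^ k n < q n ∧ n ^ 6 < q n := by
      -- For bounded `k` any fixed power of `n` is eventually below `q`; for `k` tending to
      -- infinity, `k ≥ 6` eventually.
      rcases hkq with ⟨⟨B, hB⟩, hd⟩ | ⟨hk, hd⟩
      · filter_upwards [hd B, hd 6, Filter.eventually_ge_atTop 1] with n h1 h2 h3
        exact ⟨lt_of_le_of_lt (Nat.pow_le_pow_right h3 (hB n)) h1, h2⟩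
      · filter_upwards [hd, hk.eventually_ge_atTop 6, Filter.eventually_ge_atTop 1]
          with n h1 h2 h3
        exact ⟨h1, lt_of_le_of_lt (Nat.pow_le_pow_right h3 h2) h1⟩
    filter_upwards [h1, Filter.eventually_ge_atTop 4] with n h2 h3 h4
    exact ⟨h2.1, (soundness_bound h3 h4).trans h2.2.le⟩
  -- Completeness and soundness are required for every `n`, but `q` is large only eventually. At the
  -- other `n` a larger prime is used, which does not affect the asymptotic bounds.
  have hprime : ∀ n, ∃ p, p.Prime ∧ Good n p ∧ (Good n (q n) → p = q n) := by
    intro n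
    by_cases h : Good n (q n)
    · exact ⟨q n, hq n, h, fun _ => rfl⟩
    · obtain ⟨p, hp, hp'⟩ := Nat.exists_infinite_primes (n ^ k n + 1 +
        3 * ((k n * Nat.clog 2 n + 1) * n + n * (k n * Nat.clog 2 n + k n + 1) +
          (k n * Nat.clog 2 n + k n + 2)))
      exact ⟨p, hp', ⟨by omega, by omega⟩, fun hc => absurd hc h⟩
  choose p hp hpg hpq using hprime
  -- Outside these cases there is at least one factor, and its polynomial degrees stay below `n`.
  let triv : ℕ → Prop := fun n => k n ≤ 1 ∨ n < k n
  have hbits : ∀ w : ℕ, w ≤ 6 → ∀ᶠ n : ℕ in Filter.atTop,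
      ((if triv n then 0 else w * Nat.clog 2 (p n) : ℕ) : ℝ) ≤ (20 : ℕ) * Real.log (q n) := by
    intro w hw
    filter_upwards [hgood, Filter.eventually_ge_atTop 2] with n h1 h2
    have hw' : (w : ℝ) ≤ 6 := by exact_mod_cast hw
    split_ifs with h
    · have := Real.log_natCast_nonneg (q n)
      simp only [Nat.cast_zero, Nat.cast_ofNat]
      positivity
    · have hk : 2 ≤ k n ∧ k n ≤ n := by
        simp only [triv] at h
        omega
      have hg := h1 hk.2
      rw [hpq n hg]
      have h3 : 3 ≤ q n := by
        have : 1 ≤ n ^ k n := Nat.one_le_pow _ _ (by omega)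
        have h4 : 2 ^ 2 ≤ n ^ k n := (Nat.pow_le_pow_left h2 2).trans
          (Nat.pow_le_pow_right (by omega) hk.1)
        have := hg.1
        omega
      have h5 := clog_le_log h3
      have h6 := Real.log_natCast_nonneg (q n)
      have h7 : (0 : ℝ) ≤ Nat.clog 2 (q n) := by positivity
      push_cast
      nlinarith
  refine ⟨fun n => if triv n then 0 else 2 * (k n * Nat.clog 2 n + k n + 1),
    fun n => if triv n then 0 else 6 * Nat.clog 2 (p n),
    ⟨1, fun n => if triv n then 0 else 4 * Nat.clog 2 (p n)⟩, ?_, hbits 6 le_rfl, by norm_num,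
    hbits 4 (by norm_num), dStatZK_of_hasProtocol fun n => ?_⟩
  · filter_upwards [Filter.eventually_ge_atTop 3] with n hn
    have h0 := Real.log_natCast_nonneg n
    split_ifs with h
    · simp only [Nat.cast_zero, Nat.cast_ofNat]
      positivity
    · have hk : 2 ≤ k n := by
        simp only [triv] at h
        omega
      have h1 := clog_le_log hn
      have hk' : (2 : ℝ) ≤ k n := by exact_mod_cast hk
      have h2 : (1 : ℝ) ≤ Real.log n := by
        have hn' : (3 : ℝ) ≤ n := by exact_mod_cast hn
        rw [Real.le_log_iff_exp_le (by linarith)]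
        linarith [Real.exp_one_lt_d9]
      have h3 : (k n : ℝ) * Nat.clog 2 n ≤ k n * (3 * Real.log n) := by gcongr
      have h4 : (k n : ℝ) ≤ k n * Real.log n := by nlinarith
      push_cast
      nlinarith
  · by_cases h : triv n
    · rw [if_pos h, if_pos h, if_pos h]
      -- The count is the same for all graphs here, so it can be read off from the empty graph.
      refine hasProtocol_const n (count n ⊥) (L n) fun N => ?_
      have hconst : count n N.graph = count n ⊥ := by
        refine Nat.eq_of_mul_eq_mul_right (haut n) ?_
        rw [hcount, hcount]
        exact tupleCount_const h _ _ _
      rw [hL]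
      constructor
      · rintro ⟨Δ, h1, h2⟩ v
        rw [h1, ← h2, hconst]
      · intro h1
        exact ⟨_, h1, hconst⟩
    · have hk : 2 ≤ k n ∧ k n ≤ n := by
        simp only [triv] at h
        omega
      rw [if_neg h, if_neg h, if_neg h]
      have : Fact (p n).Prime := ⟨hp n⟩
      refine hasProtocol_tupleCount hk.1 hk.2 (pat n) (haut n) (hpg n).1 (hpg n).2
        (Nat.le_pow_clog (by norm_num) _) (L n) fun N => ?_
      rw [hL]
      constructor
      · rintro ⟨Δ, h1, h2⟩
        exact ⟨Δ, h1, by rw [← hcount, h2]⟩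
      · rintro ⟨Δ, h1, h2⟩
        refine ⟨Δ, h1, Nat.eq_of_mul_eq_mul_right (haut n) ?_⟩
        rw [hcount, h2]

end DistZK

end

theorem mainTheorem3 :
    ∃ K : ℕ, ∀ (k q : ℕ → ℕ) (H : (n : ℕ) → SimpleGraph (Fin (k n))),
      (∀ n, (q n).Prime) →
      (((∃ B : ℕ, ∀ n, k n ≤ B) ∧ ∀ d : ℕ, ∀ᶠ n : ℕ in Filter.atTop, n ^ d < q n) ∨
        (Filter.Tendsto k Filter.atTop Filter.atTop ∧
          ∀ᶠ n : ℕ in Filter.atTop, n ^ k n < q n)) →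
      ∀ L ∈ ({DistZK.subgraphCounting H, DistZK.inducedSubgraphCounting H} :
          Set (DistZK.DistLanguage ℕ)),
        ∃ (r ℓ : ℕ → ℕ) (A : DistZK.AlgClass),
          (∀ᶠ n : ℕ in Filter.atTop, (r n : ℝ) ≤ K * (k n * Real.log n)) ∧
          (∀ᶠ n : ℕ in Filter.atTop, (ℓ n : ℝ) ≤ K * Real.log (q n)) ∧
          A.rounds ≤ K ∧
          (∀ᶠ n : ℕ in Filter.atTop, (A.bits n : ℝ) ≤ K * Real.log (q n)) ∧
          DistZK.DStatZK r ℓ A A L := by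
  refine ⟨20, fun k q H hq hkq L hL => ?_⟩
  rcases hL with rfl | rfl
  · exact DistZK.exists_params k q hq hkq (fun n G => G.copyCount (H n))
      (fun n => DistZK.copyPat (H n)) (fun n => Nat.card (H n ≃g H n))
      (fun n => DistZK.card_iso_self_pos (H n))
      (fun n G => DistZK.copyCount_mul_card_iso G (H n)) _ fun n => rfl
  · exact DistZK.exists_params k q hq hkq (fun n G => DistZK.inducedCopyCount G (H n))
      (fun n => DistZK.inducedPat (H n)) (fun n => Nat.card (H n ≃g H n))
      (fun n => DistZK.card_iso_self_pos (H n))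
      (fun n G => DistZK.inducedCopyCount_mul_card_iso G (H n)) _ fun n => rfl
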